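/- Let $1<p<\infty$ and let $a:(0,\infty)\to[0,\infty)$ be a measurable function. For measurable $f:\mathbb R\to\mathbb C$ put $$S_af(x)=\int_0^\infty f(tx)\,a(t)\,dt,\qquad x\in\mathbb R,$$ and for $f\in L^p(\mathbb R)$ let $$Hf(x)=\frac1\pi\,\mathrm{p.v.}\!\int_{-\infty}^{\infty}\frac{f(y)}{x-y}\,dy=\lim_{\varepsilon\to0^+}\frac1\pi\int_{|x-y|>\varepsilon}\frac{f(y)}{x-y}\,dy$$ be its Hilbert transform. We say that $S_a$ is bounded on $L^p(\mathbb R)$ if, for every $f\in L^p(\mathbb R)$, the integral defining $S_af(x)$ converges absolutely for almost every $x\in\mathbb R$ and $S_af\in L^p(\mathbb R)$, and there is a finite constant $C$, independent of $f$, with $\|S_af\|_{L^p(\mathbb R)}\le C\|f\|_{L^p(\mathbb R)}$ for all $f\in L^p(\mathbb R)$. Then $S_a$ is bounded on $L^p(\mathbb R)$ if and only if $$\int_0^\infty t^{-1/p}a(t)\,dt<\infty.$$ Moreover, in that case, $$\|S_a\|_{L^p(\mathbb R)\to L^p(\mathbb R)}=\int_0^\infty t^{-1/p}a(t)\,dt,$$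 and $S_a$ commutes with the Hilbert transform on $L^p(\mathbb R)$: for every $f\in L^p(\mathbb R)$, the limit defining $Hf(x)$ exists for almost every $x$, $Hf\in L^p(\mathbb R)$, and $S_a(Hf)=H(S_af)$ almost everywhere. -/

import Mathlib

open MeasureTheory Filter Topology Set
open scoped ENNReal

noncomputable section

/-- The operator `S_a f (x) = ∫_0^∞ f(t x) a(t) dt`. Only the values of `a` on `(0, ∞)` matter. -/
def adjHausdorff (a : ℝ → ℝ) (f : ℝ → ℂ) (x : ℝ) : ℂ :=
  ∫ t in Ioi (0 : ℝ), f (t * x) * (a t : ℂ)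

/-- `S_a` is bounded on `L^p(ℝ)`: for every `f ∈ L^p(ℝ)` the integral that defines `S_a f (x)`
converges absolutely for almost every `x`, the function `S_a f` is in `L^p(ℝ)`, and
`‖S_a f‖_p ≤ C ‖f‖_p` with a finite constant `C` independent of `f`. -/
def AdjHausdorffBounded (p : ℝ≥0∞) (a : ℝ → ℝ) : Prop :=
  ∃ C : ℝ≥0∞, C < ∞ ∧ ∀ f : ℝ → ℂ, MemLp f p volume →
    (∀ᵐ x : ℝ, IntegrableOn (fun t : ℝ => f (t * x) * (a t : ℂ)) (Ioi 0) volume) ∧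
    MemLp (adjHausdorff a f) p volume ∧
    eLpNorm (adjHausdorff a f) p volume ≤ C * eLpNorm f p volume

/-- The operator norm of `S_a` on `L^p(ℝ)`: the infimum of all `C ∈ [0, ∞]` such that
`‖S_a f‖_p ≤ C ‖f‖_p` for all `f ∈ L^p(ℝ)`. -/
def adjHausdorffNorm (p : ℝ≥0∞) (a : ℝ → ℝ) : ℝ≥0∞ :=
  sInf {C : ℝ≥0∞ | ∀ f : ℝ → ℂ, MemLp f p volume →
    eLpNorm (adjHausdorff a f) p volume ≤ C * eLpNorm f p volume}

/-- The truncated Hilbert transform `(1/π) ∫_{|x - y| > ε} f(y) / (x - y) dy`. -/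
def truncHilbert (f : ℝ → ℂ) (x ε : ℝ) : ℂ :=
  ((1 / Real.pi : ℝ) : ℂ) * ∫ y in {y : ℝ | ε < |x - y|}, f y / ((x - y : ℝ) : ℂ)

/-- The principal value that defines the Hilbert transform of `f` exists at `x`. -/
def HilbertPVExists (f : ℝ → ℂ) (x : ℝ) : Prop :=
  ∃ l : ℂ, Tendsto (truncHilbert f x) (𝓝[>] 0) (𝓝 l)

/-- The Hilbert transform `H f (x) = (1/π) p.v. ∫ f(y) / (x - y) dy`. -/
def hilbertTransform (f : ℝ → ℂ) (x : ℝ) : ℂ :=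
  limUnder (𝓝[>] 0) (truncHilbert f x)

end

/-! Write M for the weighted integral `hausdorffWeight`, and P_ε, Q_ε for convolution with the
Poisson and conjugate Poisson kernels.

Boundedness and norm. Since f(t·) has norm t^(-1/p)‖f‖_p, a Minkowski-type inequality gives ‖S_a
f‖_p ≤ M‖f‖_p. The constant is optimal because the power x^(-1/p-δ), cut off to x > 1, is almost an
eigenfunction: for x > N its image is at least x^(-1/p-δ) times the integral of t^(-1/p-δ) a(t) over
t > 1/N. With δ = 1/N → 0, Fatou's lemma gives M ≤ C for every admissible C
(`hausdorffWeight_le_of_bound`).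

Commutation. Formally H commutes with positive dilations, but a principal value cannot simply be
interchanged with the integral in t. The absolutely convergent Q_ε replaces it. For f in L^p there
is h in L^p with Q_ε f = P_ε h for all ε > 0 (`exists_conjPoisson_eq_poisson`). At Lebesgue points
P_ε h tends to h and the truncated Hilbert integral differs from Q_ε f by o(1), so these identities
force Hf = h almost everywhere (`hilbertTransform_ae_eq`). They survive S_a: dilation by t turns ε
into tε in both kernels, and Fubini applies (`conjPoisson_adjHausdorff`).

The existence of h rests on M. Riesz's theorem, a bound for Q_ε on L^p uniform in ε
(`conjPoissonBound`): for p ≤ 2 by Cauchy's theorem applied to the p-th power of a holomorphic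
function with positive real part, for p > 2 by duality. -/

/-! ### A Minkowski-type inequality -/

/-- Hölder against the constant 1 in t, then Tonelli. This replaces Minkowski's inequality when the
slices share one bound and the weight is absorbed in μ: the Poisson kernel for P_ε, the density
t^(-1/p) a(t) for S_a. -/
theorem lintegral_rpow_lintegral_le {T X : Type*} [MeasurableSpace T] [MeasurableSpace X]
    (μ : Measure T) (ν : Measure X) [SFinite μ] [SFinite ν] {p : ℝ} (hp : 1 < p)
    {g : T → X → ℝ≥0∞} (hg : Measurable (Function.uncurry g)) {B : ℝ≥0∞}
    (hB : ∀ᵐ t ∂μ, ∫⁻ x, g t x ^ p ∂ν ≤ B) :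
    ∫⁻ x, (∫⁻ t, g t x ∂μ) ^ p ∂ν ≤ μ univ ^ p * B := by
  have hpq := Real.HolderConjugate.conjExponent hp
  have h1 : ∀ x, (∫⁻ t, g t x ∂μ) ^ p ≤ μ univ ^ (p - 1) * ∫⁻ t, g t x ^ p ∂μ := by
    intro x
    have h := ENNReal.lintegral_mul_le_Lp_mul_Lq μ hpq (f := fun t => g t x) (g := fun _ => 1)
      (by fun_prop) (by fun_prop)
    simp only [Pi.mul_apply, mul_one, ENNReal.one_rpow, lintegral_const, one_mul] at h
    calc (∫⁻ t, g t x ∂μ) ^ p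
        ≤ ((∫⁻ t, g t x ^ p ∂μ) ^ (1 / p) * μ univ ^ (1 / p.conjExponent)) ^ p := by
          gcongr
      _ = _ := by
          rw [ENNReal.mul_rpow_of_nonneg _ _ (by linarith), ← ENNReal.rpow_mul,
            ← ENNReal.rpow_mul, one_div_mul_cancel (by linarith), ENNReal.rpow_one, mul_comm]
          congr 2
          rw [Real.conjExponent]
          field_simp
  calc ∫⁻ x, (∫⁻ t, g t x ∂μ) ^ p ∂ν
      ≤ ∫⁻ x, μ univ ^ (p - 1) * ∫⁻ t, g t x ^ p ∂μ ∂ν := lintegral_mono h1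
    _ = μ univ ^ (p - 1) * ∫⁻ x, ∫⁻ t, g t x ^ p ∂μ ∂ν := by
        rw [lintegral_const_mul]
        exact Measurable.lintegral_prod_left' (f := fun z : T × X => g z.1 z.2 ^ p) (by fun_prop)
    _ = μ univ ^ (p - 1) * ∫⁻ t, ∫⁻ x, g t x ^ p ∂ν ∂μ := by
        rw [lintegral_lintegral_swap]
        fun_prop
    _ ≤ μ univ ^ (p - 1) * ∫⁻ _, B ∂μ := by
        gcongr 1
        exact lintegral_mono_ae hB
    _ = μ univ ^ p * B := by
        rw [lintegral_const, mul_comm B, ← mul_assoc]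
        congr 1
        nth_rewrite 2 [← ENNReal.rpow_one (μ univ)]
        rw [← ENNReal.rpow_add_of_nonneg _ _ (by linarith) (by norm_num)]
        congr 1; ring

theorem enorm_ofReal_complex (r : ℝ) : ‖(r : ℂ)‖ₑ = ‖r‖ₑ := by
  rw [← ofReal_norm, Complex.norm_real, ofReal_norm]

/-! ### Convolution with kernels that decay like 1/|y| -/

/-- The convolution of a real kernel with a complex function. -/
noncomputable def kconv (K : ℝ → ℝ) (f : ℝ → ℂ) (x : ℝ) : ℂ := ∫ y, (K (x - y) : ℂ) * f y

/-- Kernels that decay at least like `1 / |y|`. -/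
structure KernelBound (K : ℝ → ℝ) : Prop where
  measurable : Measurable K
  bound : ∃ C : ℝ, 0 ≤ C ∧ ∀ y, |K y| ≤ C * (1 + |y|)⁻¹

theorem memLp_inv_one_add_abs {q : ℝ} (hq : 1 < q) :
    MemLp (fun y : ℝ => (1 + |y|)⁻¹) (ENNReal.ofReal q) volume := by
  rw [← integrable_norm_rpow_iff (by fun_prop) (by simp; linarith) (by simp)]
  have := integrable_one_add_norm (E := ℝ) (μ := volume) (r := q) (by simpa using hq)
  refine this.congr (ae_of_all _ fun y => ?_)
  have h0 : (0 : ℝ) ≤ 1 + |y| := by positivity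
  simp only [Real.norm_eq_abs, abs_inv, abs_of_nonneg h0]
  rw [ENNReal.toReal_ofReal (by linarith), Real.inv_rpow h0, Real.rpow_neg h0]

namespace KernelBound

variable {K L : ℝ → ℝ}

/-- Such kernels need not be integrable, but membership in every L^q with q > 1 makes the
convolution with an L^p function converge absolutely at every point, by Hölder. -/
theorem memLp (hK : KernelBound K) {q : ℝ} (hq : 1 < q) :
    MemLp K (ENNReal.ofReal q) volume := by
  obtain ⟨C, hC, h⟩ := hK.bound
  refine MemLp.mono ((memLp_inv_one_add_abs hq).const_mul C) hK.measurable.aestronglyMeasurable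
    (ae_of_all _ fun y => ?_)
  rw [Real.norm_eq_abs]
  exact (h y).trans (le_abs_self _)

theorem sub (hK : KernelBound K) (hL : KernelBound L) : KernelBound (fun y => K y - L y) := by
  obtain ⟨C, hC, h⟩ := hK.bound
  obtain ⟨D, hD, h'⟩ := hL.bound
  refine ⟨hK.measurable.sub hL.measurable, C + D, by positivity, fun y => ?_⟩
  calc |K y - L y| ≤ |K y| + |L y| := abs_sub _ _
    _ ≤ _ := by rw [add_mul]; exact add_le_add (h y) (h' y)

theorem lintegral_mul_le (hK : KernelBound K) {p : ℝ} (hp : 1 < p) {f : ℝ → ℂ}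
    (hf : AEStronglyMeasurable f volume) (x : ℝ) :
    ∫⁻ y, ‖(K (x - y) : ℂ) * f y‖ₑ ≤
      eLpNorm K (ENNReal.ofReal p.conjExponent) volume * eLpNorm f (ENNReal.ofReal p) volume := by
  have hpq := Real.HolderConjugate.conjExponent hp
  have hq : 1 < p.conjExponent := hpq.symm.lt
  have hm : Measurable fun y => K (x - y) := hK.measurable.comp (by fun_prop)
  have h1 : eLpNorm K (ENNReal.ofReal p.conjExponent) volume =
      eLpNorm (fun y => K (x - y)) (ENNReal.ofReal p.conjExponent) volume := by
    symm
    exact eLpNorm_comp_measurePreserving (f := fun y => x - y)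
      hK.measurable.aestronglyMeasurable (volume.measurePreserving_sub_left x)
  rw [h1, eLpNorm_eq_lintegral_rpow_enorm_toReal (by simp; linarith) (by simp),
    eLpNorm_eq_lintegral_rpow_enorm_toReal (by simp; linarith) (by simp),
    ENNReal.toReal_ofReal (by linarith), ENNReal.toReal_ofReal (by linarith)]
  refine le_trans (le_of_eq ?_) (ENNReal.lintegral_mul_le_Lp_mul_Lq volume hpq.symm
    (f := fun y => ‖K (x - y)‖ₑ) (g := fun y => ‖f y‖ₑ) hm.enorm.aemeasurable hf.enorm)
  refine lintegral_congr fun y => ?_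
  rw [enorm_mul, Pi.mul_apply, enorm_ofReal_complex]

theorem integrable_mul (hK : KernelBound K) {p : ℝ} (hp : 1 < p) {f : ℝ → ℂ}
    (hf : MemLp f (ENNReal.ofReal p) volume) (x : ℝ) :
    Integrable (fun y => (K (x - y) : ℂ) * f y) volume := by
  have hm : Measurable fun y => K (x - y) := hK.measurable.comp (by fun_prop)
  refine ⟨(Complex.measurable_ofReal.comp hm).aestronglyMeasurable.mul hf.1, ?_⟩
  refine lt_of_le_of_lt (hK.lintegral_mul_le hp hf.1 x) (ENNReal.mul_lt_top ?_ hf.2)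
  exact (hK.memLp (Real.HolderConjugate.conjExponent hp).symm.lt).2

theorem enorm_kconv_le (hK : KernelBound K) {p : ℝ} (hp : 1 < p) {f : ℝ → ℂ}
    (hf : AEStronglyMeasurable f volume) (x : ℝ) :
    ‖kconv K f x‖ₑ ≤
      eLpNorm K (ENNReal.ofReal p.conjExponent) volume * eLpNorm f (ENNReal.ofReal p) volume :=
  (enorm_integral_le_lintegral_enorm _).trans (hK.lintegral_mul_le hp hf x)

theorem kconv_sub (hK : KernelBound K) {p : ℝ} (hp : 1 < p) {f g : ℝ → ℂ}
    (hf : MemLp f (ENNReal.ofReal p) volume) (hg : MemLp g (ENNReal.ofReal p) volume) :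
    kconv K (f - g) = kconv K f - kconv K g := by
  ext x
  simp only [kconv, Pi.sub_apply, mul_sub]
  exact integral_sub (hK.integrable_mul hp hf x) (hK.integrable_mul hp hg x)

theorem kconv_add (hK : KernelBound K) {p : ℝ} (hp : 1 < p) {f g : ℝ → ℂ}
    (hf : MemLp f (ENNReal.ofReal p) volume) (hg : MemLp g (ENNReal.ofReal p) volume) :
    kconv K (f + g) = kconv K f + kconv K g := by
  ext x
  simp only [kconv, Pi.add_apply, mul_add]
  exact integral_add (hK.integrable_mul hp hf x) (hK.integrable_mul hp hg x)

theorem aestronglyMeasurable_kconv (hK : KernelBound K) {f : ℝ → ℂ}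
    (hf : AEStronglyMeasurable f volume) : AEStronglyMeasurable (kconv K f) volume := by
  have hm : Measurable fun z : ℝ × ℝ => K (z.1 - z.2) := hK.measurable.comp (by fun_prop)
  exact AEStronglyMeasurable.integral_prod_right' (f := fun z : ℝ × ℝ => (K (z.1 - z.2) : ℂ) * f z.2)
    ((Complex.measurable_ofReal.comp hm).aestronglyMeasurable.mul hf.comp_snd)

/-- Hölder makes f ↦ (K * f)(x) continuous on L^p for each fixed x, so convolution identities pass
to L^p limits at every point. -/
theorem tendsto_kconv (hK : KernelBound K) {p : ℝ} (hp : 1 < p) {ι : Type*} {l : Filter ι}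
    {f : ι → ℝ → ℂ} {g : ℝ → ℂ} (hf : ∀ i, MemLp (f i) (ENNReal.ofReal p) volume)
    (hg : MemLp g (ENNReal.ofReal p) volume)
    (h : Tendsto (fun i => eLpNorm (f i - g) (ENNReal.ofReal p) volume) l (𝓝 0)) (x : ℝ) :
    Tendsto (fun i => kconv K (f i) x) l (𝓝 (kconv K g x)) := by
  rw [tendsto_iff_edist_tendsto_0]
  have h' : Tendsto (fun i => eLpNorm K (ENNReal.ofReal p.conjExponent) volume *
      eLpNorm (f i - g) (ENNReal.ofReal p) volume) l (𝓝 0) := by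
    have := ENNReal.Tendsto.const_mul (a := eLpNorm K (ENNReal.ofReal p.conjExponent) volume) h
      (Or.inr (hK.memLp (Real.HolderConjugate.conjExponent hp).symm.lt).2.ne)
    simpa using this
  refine tendsto_of_tendsto_of_tendsto_of_le_of_le tendsto_const_nhds h' (fun _ => zero_le) ?_
  intro i
  have := hK.enorm_kconv_le hp ((hf i).sub hg).1 x
  rwa [hK.kconv_sub hp (hf i) hg, Pi.sub_apply, ← edist_eq_enorm_sub] at this

end KernelBound

theorem kconv_congr_ae (K : ℝ → ℝ) {f g : ℝ → ℂ} (h : f =ᵐ[volume] g) : kconv K f = kconv K g := by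
  ext x
  exact integral_congr_ae (h.mono fun y hy => by simp only [hy])

theorem kconv_comp_mul_left (K : ℝ → ℝ) (f : ℝ → ℂ) {t : ℝ} (ht : 0 < t) (x : ℝ) :
    kconv K (fun y => f (t * y)) x = kconv (fun y => t⁻¹ * K (t⁻¹ * y)) f (t * x) := by
  have := Measure.integral_comp_mul_left (fun y => (K (x - t⁻¹ * y) : ℂ) * f y) t
  simp only [inv_mul_cancel_left₀ ht.ne'] at this
  rw [kconv, this, kconv, abs_of_pos (inv_pos.2 ht), ← integral_smul]
  congr 1
  ext y
  rw [mul_sub, inv_mul_cancel_left₀ ht.ne', Complex.real_smul]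
  push_cast
  ring

/-! ### The Poisson, conjugate Poisson and truncated Hilbert kernels -/

/-- The Poisson kernel of the upper half plane. -/
noncomputable def poissonKer (ε y : ℝ) : ℝ := ε / (Real.pi * (y ^ 2 + ε ^ 2))

/-- The conjugate Poisson kernel of the upper half plane. -/
noncomputable def conjPoissonKer (ε y : ℝ) : ℝ := y / (Real.pi * (y ^ 2 + ε ^ 2))

/-- The truncated Hilbert kernel. -/
noncomputable def truncKer (ε y : ℝ) : ℝ := if ε < |y| then 1 / (Real.pi * y) else 0

theorem poissonKer_nonneg {ε : ℝ} (hε : 0 < ε) (y : ℝ) : 0 ≤ poissonKer ε y := by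
  unfold poissonKer; positivity

theorem poissonKer_pos {ε : ℝ} (hε : 0 < ε) (y : ℝ) : 0 < poissonKer ε y := by
  unfold poissonKer; positivity

theorem conjPoissonKer_neg (ε y : ℝ) : conjPoissonKer ε (-y) = -conjPoissonKer ε y := by
  simp [conjPoissonKer, neg_div]

theorem measurable_poissonKer (ε : ℝ) : Measurable (poissonKer ε) := by
  unfold poissonKer; fun_prop

theorem kernelBound_poissonKer {ε : ℝ} (hε : 0 < ε) : KernelBound (poissonKer ε) := by
  refine ⟨measurable_poissonKer ε, (1 / ε + 1) / Real.pi, by positivity, fun y => ?_⟩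
  rw [abs_of_nonneg (poissonKer_nonneg hε y), poissonKer, ← div_eq_mul_inv, div_div,
    div_le_div_iff₀ (by positivity) (by positivity)]
  have h1 : ε * (1 + |y|) ≤ (1 / ε + 1) * (y ^ 2 + ε ^ 2) := by
    have h2 : (1 / ε + 1) * (y ^ 2 + ε ^ 2) = y ^ 2 / ε + ε + y ^ 2 + ε ^ 2 := by
      field_simp
      ring
    rw [h2]
    have : 0 ≤ y ^ 2 / ε := by positivity
    nlinarith [sq_abs y, sq_nonneg (|y| - ε)]
  nlinarith [Real.pi_pos]

theorem kernelBound_conjPoissonKer {ε : ℝ} (hε : 0 < ε) : KernelBound (conjPoissonKer ε) := by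
  refine ⟨by unfold conjPoissonKer; fun_prop, (1 / ε + 1) / Real.pi, by positivity, fun y => ?_⟩
  rw [conjPoissonKer, abs_div, abs_of_pos (show 0 < Real.pi * (y ^ 2 + ε ^ 2) by positivity),
    ← div_eq_mul_inv, div_div, div_le_div_iff₀ (by positivity) (by positivity)]
  have h1 : |y| * (1 + |y|) ≤ (1 / ε + 1) * (y ^ 2 + ε ^ 2) := by
    have h2 : (1 / ε + 1) * (y ^ 2 + ε ^ 2) = (y ^ 2 + ε ^ 2) / ε + y ^ 2 + ε ^ 2 := by
      field_simp
      ring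
    rw [h2]
    have : |y| ≤ (y ^ 2 + ε ^ 2) / ε := by
      rw [le_div_iff₀ hε]
      nlinarith [sq_abs y, sq_nonneg (|y| - ε)]
    nlinarith [sq_abs y]
  nlinarith [Real.pi_pos]

theorem kernelBound_truncKer {ε : ℝ} (hε : 0 < ε) : KernelBound (truncKer ε) := by
  refine ⟨?_, (1 / ε + 1) / Real.pi, by positivity, fun y => ?_⟩
  · unfold truncKer
    exact Measurable.ite (measurableSet_lt measurable_const measurable_norm) (by fun_prop)
      measurable_const
  rw [truncKer]
  split_ifs with h
  · have hy : 0 < |y| := hε.trans h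
    rw [abs_div, abs_mul, abs_one, abs_of_pos Real.pi_pos, ← div_eq_mul_inv, div_div,
      div_le_div_iff₀ (by positivity) (by positivity)]
    have : 1 + |y| ≤ (1 / ε + 1) * |y| := by
      rw [add_mul, one_mul]
      gcongr
      rw [one_div, inv_mul_eq_div, le_div_iff₀ hε]
      linarith
    nlinarith [Real.pi_pos]
  · rw [abs_zero]; positivity

theorem truncHilbert_eq_kconv (f : ℝ → ℂ) (x ε : ℝ) :
    truncHilbert f x ε = kconv (truncKer ε) f x := by
  rw [truncHilbert, kconv, ← integral_const_mul, ← integral_indicator]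
  · congr 1
    ext y
    by_cases h : ε < |x - y|
    · rw [indicator_of_mem (by exact h), truncKer, if_pos h]
      push_cast
      rw [one_div, one_div, mul_inv, div_eq_mul_inv]
      ring
    · rw [indicator_of_notMem (by exact h), truncKer, if_neg h]
      simp
  · exact measurableSet_lt measurable_const (by fun_prop)

/-- The difference is the Poisson kernel times ε/y when |y| > ε, and times -y/ε otherwise. This
domination reduces the principal value to conjugate Poisson integrals at Lebesgue points. -/
theorem abs_truncKer_sub_conjPoissonKer_le {ε : ℝ} (hε : 0 < ε) (y : ℝ) :
    |truncKer ε y - conjPoissonKer ε y| ≤ poissonKer ε y := by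
  rw [truncKer, conjPoissonKer, poissonKer]
  have hπ := Real.pi_pos
  split_ifs with h
  · have hy : 0 < |y| := hε.trans h
    have hy0 : y ≠ 0 := abs_pos.1 hy
    have : 1 / (Real.pi * y) - y / (Real.pi * (y ^ 2 + ε ^ 2)) =
        ε ^ 2 / (Real.pi * (y ^ 2 + ε ^ 2)) / y := by
      field_simp
      ring
    rw [this, abs_div, abs_of_nonneg (by positivity), div_le_iff₀ hy, div_mul_eq_mul_div]
    gcongr
    nlinarith
  · rw [zero_sub, abs_neg, abs_div, abs_of_pos (show 0 < Real.pi * (y ^ 2 + ε ^ 2) by positivity)]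
    gcongr
    exact not_lt.1 h

theorem integral_poissonKer {ε : ℝ} (hε : 0 < ε) :
    Integrable (poissonKer ε) volume ∧ ∫ y, poissonKer ε y = 1 := by
  have h : poissonKer ε = fun y => (Real.pi * ε)⁻¹ * (1 + (ε⁻¹ * y) ^ 2)⁻¹ := by
    ext y
    rw [poissonKer]
    field_simp
    ring
  constructor
  · rw [h]
    exact (integrable_inv_one_add_sq.comp_mul_left' (inv_ne_zero hε.ne')).const_mul _
  · rw [h, integral_const_mul, Measure.integral_comp_mul_left (fun y : ℝ => (1 + y ^ 2)⁻¹),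
      integral_univ_inv_one_add_sq, inv_inv, abs_of_pos hε, smul_eq_mul]
    field_simp

theorem lintegral_poissonKer {ε : ℝ} (hε : 0 < ε) :
    ∫⁻ y, ENNReal.ofReal (poissonKer ε y) = 1 := by
  rw [← ofReal_integral_eq_lintegral_ofReal (integral_poissonKer hε).1
    (ae_of_all _ (poissonKer_nonneg hε)), (integral_poissonKer hε).2, ENNReal.ofReal_one]

theorem lintegral_poisson_rpow_le {ε : ℝ} (hε : 0 < ε) {p : ℝ} (hp : 1 < p) {f : ℝ → ℂ}
    (hf : AEStronglyMeasurable f volume) :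
    ∫⁻ x, (∫⁻ y, ‖(poissonKer ε (x - y) : ℂ) * f y‖ₑ) ^ p ≤ ∫⁻ x, ‖f x‖ₑ ^ p := by
  set g := hf.mk f
  have hfg := hf.ae_eq_mk
  have hg : Measurable g := hf.stronglyMeasurable_mk.measurable
  have e1 : ∫⁻ x, ‖f x‖ₑ ^ p = ∫⁻ x, ‖g x‖ₑ ^ p :=
    lintegral_congr_ae (hfg.mono fun x hx => by simp only [hx, g])
  set μ : Measure ℝ := volume.withDensity fun y => ENNReal.ofReal (poissonKer ε y)
  have hμ : μ univ = 1 := by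
    simp only [μ, withDensity_apply _ MeasurableSet.univ, Measure.restrict_univ]
    exact lintegral_poissonKer hε
  have e2 : ∀ x, ∫⁻ y, ‖(poissonKer ε (x - y) : ℂ) * f y‖ₑ = ∫⁻ y, ‖g (x - y)‖ₑ ∂μ := by
    intro x
    rw [lintegral_withDensity_eq_lintegral_mul _ (measurable_poissonKer ε).ennreal_ofReal
      (by fun_prop)]
    conv_rhs => rw [← lintegral_sub_left_eq_self _ x]
    refine lintegral_congr_ae (hfg.mono fun y hy => ?_)
    simp only [Pi.mul_apply, sub_sub_cancel, enorm_mul, enorm_ofReal_complex, hy, g]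
    rw [Real.enorm_of_nonneg (poissonKer_nonneg hε _)]
  rw [e1]
  simp only [e2]
  have := lintegral_rpow_lintegral_le μ volume hp (g := fun y x => ‖g (x - y)‖ₑ)
    (B := ∫⁻ x, ‖g x‖ₑ ^ p) (by unfold Function.uncurry; fun_prop)
    (ae_of_all _ fun t => (lintegral_sub_right_eq_self (fun x => ‖g x‖ₑ ^ p) t).le)
  rwa [hμ, ENNReal.one_rpow, one_mul] at this

theorem eLpNorm_le_of_lintegral_rpow_le {f : ℝ → ℂ} {p : ℝ} (hp : 1 < p) {B : ℝ≥0∞}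
    (h : ∫⁻ x, ‖f x‖ₑ ^ p ≤ B ^ p) : eLpNorm f (ENNReal.ofReal p) volume ≤ B := by
  rw [eLpNorm_eq_lintegral_rpow_enorm_toReal (by simp; linarith) (by simp),
    ENNReal.toReal_ofReal (by linarith)]
  calc _ ≤ (B ^ p) ^ (1 / p) := by gcongr
    _ = B := by rw [← ENNReal.rpow_mul, mul_one_div_cancel (by linarith), ENNReal.rpow_one]

theorem lintegral_rpow_eq_eLpNorm_rpow (f : ℝ → ℂ) {p : ℝ} (hp : 1 < p) :
    ∫⁻ x, ‖f x‖ₑ ^ p = eLpNorm f (ENNReal.ofReal p) volume ^ p := by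
  rw [eLpNorm_eq_lintegral_rpow_enorm_toReal (by simp; linarith) (by simp),
    ENNReal.toReal_ofReal (by linarith), ← ENNReal.rpow_mul, one_div_mul_cancel (by linarith),
    ENNReal.rpow_one]

theorem eLpNorm_poisson_le {ε : ℝ} (hε : 0 < ε) {p : ℝ} (hp : 1 < p) {f : ℝ → ℂ}
    (hf : AEStronglyMeasurable f volume) :
    eLpNorm (kconv (poissonKer ε) f) (ENNReal.ofReal p) volume ≤
      eLpNorm f (ENNReal.ofReal p) volume := by
  refine eLpNorm_le_of_lintegral_rpow_le hp ?_
  rw [← lintegral_rpow_eq_eLpNorm_rpow f hp]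
  refine le_trans (lintegral_mono fun x => ?_) (lintegral_poisson_rpow_le hε hp hf)
  gcongr
  exact enorm_integral_le_lintegral_enorm _

theorem memLp_poisson {ε : ℝ} (hε : 0 < ε) {p : ℝ} (hp : 1 < p) {f : ℝ → ℂ}
    (hf : MemLp f (ENNReal.ofReal p) volume) :
    MemLp (kconv (poissonKer ε) f) (ENNReal.ofReal p) volume :=
  ⟨(kernelBound_poissonKer hε).aestronglyMeasurable_kconv hf.1,
    (eLpNorm_poisson_le hε hp hf.1).trans_lt hf.2⟩

/-! ### Cauchy's theorem and the semigroup identities P_ε Q_δ = Q_(ε+δ) = Q_ε P_δ -/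

theorem kconv_kconv {K L M : ℝ → ℝ} (hK : Measurable K) (hL : Measurable L)
    (hM : ∀ u, ∫ y, K (u - y) * L y = M u) {f : ℝ → ℂ} (hf : AEStronglyMeasurable f volume)
    {x : ℝ} (hfin : ∫⁻ y, ‖K (x - y)‖ₑ * ∫⁻ z, ‖(L (y - z) : ℂ) * f z‖ₑ < ∞) :
    kconv K (kconv L f) x = kconv M f x := by
  have hm : Measurable fun z : ℝ × ℝ => L (z.1 - z.2) := hL.comp (by fun_prop)
  have hm' : Measurable fun z : ℝ × ℝ => K (x - z.1) := hK.comp (by fun_prop)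
  have hF : AEStronglyMeasurable
      (fun z : ℝ × ℝ => (K (x - z.1) : ℂ) * ((L (z.1 - z.2) : ℂ) * f z.2))
      (volume.prod volume) :=
    (Complex.measurable_ofReal.comp hm').aestronglyMeasurable.mul
      ((Complex.measurable_ofReal.comp hm).aestronglyMeasurable.mul hf.comp_snd)
  have hint : Integrable (fun z : ℝ × ℝ => (K (x - z.1) : ℂ) * ((L (z.1 - z.2) : ℂ) * f z.2))
      (volume.prod volume) := by
    refine ⟨hF, ?_⟩
    rw [HasFiniteIntegral, lintegral_prod _ hF.enorm]
    refine lt_of_eq_of_lt (lintegral_congr fun y => ?_) hfin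
    rw [← enorm_ofReal_complex, ← lintegral_const_mul' _ _ (by simp)]
    simp only [enorm_mul]
  calc kconv K (kconv L f) x
      = ∫ y, ∫ z, (K (x - y) : ℂ) * ((L (y - z) : ℂ) * f z) := by
        simp only [kconv, integral_const_mul]
    _ = ∫ z, ∫ y, (K (x - y) : ℂ) * ((L (y - z) : ℂ) * f z) := integral_integral_swap hint
    _ = ∫ z, ((∫ y, K (x - y) * L (y - z) : ℝ) : ℂ) * f z := by
        congr 1
        ext z
        rw [← integral_complex_ofReal, ← integral_mul_const]
        congr 1
        ext y
        push_cast
        ring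
    _ = kconv M f x := by
        rw [kconv]
        congr 1
        ext z
        rw [← hM, ← integral_add_right_eq_self _ z]
        simp only [add_sub_cancel_right, sub_sub, add_comm z]

theorem integrable_one_add_abs_rpow_neg {p : ℝ} (hp : 1 < p) :
    Integrable (fun x : ℝ => (1 + |x|) ^ (-p)) volume := by
  simpa using integrable_one_add_norm (E := ℝ) (μ := volume) (r := p) (by simpa using hp)

theorem tendsto_mul_one_add_rpow_neg {p : ℝ} (hp : 1 < p) :
    Tendsto (fun R : ℝ => R * (1 + R) ^ (-p)) atTop (𝓝 0) := by
  have h1 : Tendsto (fun R : ℝ => (1 + R) ^ (-(p - 1))) atTop (𝓝 0) :=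
    (tendsto_rpow_neg_atTop (by linarith)).comp (tendsto_atTop_add_const_left _ 1 tendsto_id)
  refine tendsto_of_tendsto_of_tendsto_of_le_of_le' tendsto_const_nhds h1 ?_ ?_
  · filter_upwards [eventually_ge_atTop 0] with R hR
    positivity
  · filter_upwards [eventually_ge_atTop 0] with R hR
    have h2 : (1 + R) ^ (-(p - 1)) = (1 + R) * (1 + R) ^ (-p) := by
      rw [neg_sub, sub_eq_add_neg, Real.rpow_add (by linarith), Real.rpow_one]
    rw [h2]
    gcongr
    linarith

/-- Cauchy's theorem on a horizontal line, for functions that decay faster than `1 / |z|`. -/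
theorem integral_horizontal_eq_zero {G : ℂ → ℂ} {p C ε : ℝ} (hp : 1 < p) (hε : 0 < ε)
    (hG : DifferentiableOn ℂ G {z | 0 < z.im})
    (hdec : ∀ z : ℂ, ε ≤ z.im → ‖G z‖ ≤ C * (1 + ‖z‖) ^ (-p)) :
    Integrable (fun x : ℝ => G (x + ε * Complex.I)) volume ∧
      ∫ x : ℝ, G (x + ε * Complex.I) = 0 := by
  have hC : 0 ≤ C := by
    have h := (norm_nonneg _).trans (hdec (ε * Complex.I) (by simp))
    exact nonneg_of_mul_nonneg_left h (by positivity)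
  have hint : Integrable (fun x : ℝ => G (x + ε * Complex.I)) volume := by
    refine Integrable.mono' ((integrable_one_add_abs_rpow_neg hp).const_mul C) ?_
      (ae_of_all _ fun x => ?_)
    · refine Continuous.aestronglyMeasurable (continuous_iff_continuousAt.2 fun x => ?_)
      have ho : IsOpen {z : ℂ | 0 < z.im} := isOpen_lt continuous_const Complex.continuous_im
      have h1 : ContinuousAt G (x + ε * Complex.I) :=
        (hG.differentiableAt (ho.mem_nhds (by simpa using hε))).continuousAt
      exact h1.comp (f := fun x : ℝ => (x + ε * Complex.I : ℂ)) (by fun_prop)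
    · refine (hdec _ (by simp)).trans ?_
      refine mul_le_mul_of_nonneg_left ?_ hC
      refine Real.rpow_le_rpow_of_nonpos (by positivity) ?_ (by linarith)
      have := Complex.abs_re_le_norm (x + ε * Complex.I)
      simpa using this
  refine ⟨hint, ?_⟩
  have h1 : Tendsto (fun R : ℝ => ∫ x in (-R)..R, G (x + ε * Complex.I)) atTop
      (𝓝 (∫ x : ℝ, G (x + ε * Complex.I))) :=
    intervalIntegral_tendsto_integral hint tendsto_neg_atTop_atBot tendsto_id
  refine tendsto_nhds_unique h1 ?_
  rw [tendsto_zero_iff_norm_tendsto_zero]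
  have h2 : Tendsto (fun R : ℝ => 4 * C * (R * (1 + R) ^ (-p))) atTop (𝓝 0) := by
    simpa using (tendsto_mul_one_add_rpow_neg hp).const_mul (4 * C)
  refine tendsto_of_tendsto_of_tendsto_of_le_of_le' tendsto_const_nhds h2
    (Eventually.of_forall fun _ => norm_nonneg _) ?_
  filter_upwards [eventually_gt_atTop 0] with R hR
  -- The rectangle has width 2R and height R above the line. Its other three sides have total length
  -- 4R and stay at distance at least R from 0, whence the bound 4CR(1 + R)^(-p).
  have hrect := Complex.integral_boundary_rect_eq_zero_of_differentiableOn G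
    (-R + ε * Complex.I) (R + (ε + R : ℝ) * Complex.I) (hG.mono ?_)
  swap
  · intro z hz
    have h3 := hz.2
    simp only [Complex.add_im, Complex.neg_im, Complex.ofReal_im, Complex.mul_im, Complex.I_im,
      Complex.I_re, Complex.ofReal_re, mem_preimage] at h3
    rw [uIcc_of_le (by linarith)] at h3
    have := h3.1
    simp only [Set.mem_ofPred_eq]
    linarith
  simp only [Complex.add_im, Complex.neg_im, Complex.ofReal_im, Complex.mul_im, Complex.I_im,
      Complex.I_re, Complex.ofReal_re, Complex.add_re, Complex.neg_re, Complex.mul_re, mul_zero,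
      mul_one, zero_add, neg_zero, sub_zero, add_zero] at hrect
  have hb : ∀ z : ℂ, ε ≤ z.im → R ≤ ‖z‖ → ‖G z‖ ≤ C * (1 + R) ^ (-p) := by
    intro z hz hzR
    refine (hdec z hz).trans (mul_le_mul_of_nonneg_left ?_ hC)
    exact Real.rpow_le_rpow_of_nonpos (by positivity) (by linarith) (by linarith)
  have htop : ‖∫ x in (-R)..R, G (x + (ε + R : ℝ) * Complex.I)‖ ≤
      C * (1 + R) ^ (-p) * |R - -R| := by
    refine intervalIntegral.norm_integral_le_of_norm_le_const fun x _ => hb _ ?_ ?_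
    · simp [hR.le]
    · refine le_trans ?_ (Complex.abs_im_le_norm _)
      simp only [Complex.add_im, Complex.ofReal_im, Complex.mul_im, Complex.I_im, Complex.I_re,
        Complex.ofReal_re, mul_zero, mul_one, zero_add, add_zero]
      rw [abs_of_pos (by linarith)]
      linarith
  have hside : ∀ s : ℝ, |s| = R → ‖∫ y in ε..(ε + R), G (s + y * Complex.I)‖ ≤
      C * (1 + R) ^ (-p) * |ε + R - ε| := by
    intro s hs
    refine intervalIntegral.norm_integral_le_of_norm_le_const fun y hy => hb _ ?_ ?_
    · rw [uIoc_of_le (by linarith)] at hy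
      simpa using hy.1.le
    · refine le_trans ?_ (Complex.abs_re_le_norm _)
      simp [hs]
  have hr := hside R (abs_of_pos hR)
  have hl := hside (-R) (by rw [abs_neg, abs_of_pos hR])
  rw [sub_neg_eq_add, abs_of_pos (by linarith)] at htop
  rw [add_sub_cancel_left, abs_of_pos hR] at hr hl
  have e : (∫ x in (-R)..R, G (x + ε * Complex.I)) =
      (∫ x in (-R)..R, G (x + (ε + R : ℝ) * Complex.I)) -
      Complex.I • (∫ y in ε..(ε + R), G (R + y * Complex.I)) +
      Complex.I • (∫ y in ε..(ε + R), G ((-R : ℝ) + y * Complex.I)) := by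
    linear_combination hrect
  rw [e]
  refine (norm_add_le _ _).trans ?_
  refine (add_le_add_left (norm_sub_le _ _) _).trans ?_
  rw [norm_smul, norm_smul, Complex.norm_I, one_mul, one_mul]
  linarith

/-- Supplies the decay needed for `integral_horizontal_eq_zero`: the point s - iα is at distance at
least η from z, so bounded terms can be absorbed into a multiple of that distance. -/
theorem one_add_norm_le_mul_norm_sub {z : ℂ} {η α : ℝ} (hη : 0 < η) (hα : 0 ≤ α) (hz : η ≤ z.im)
    (s : ℝ) : 1 + ‖z‖ ≤ ((1 + |s| + α) / η + 1) * ‖z - s + α * Complex.I‖ := by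
  have h1 : η ≤ ‖z - s + α * Complex.I‖ := by
    refine le_trans ?_ ((le_abs_self _).trans (Complex.abs_im_le_norm _))
    simp
    linarith
  have h2 : ‖z‖ ≤ ‖z - s + α * Complex.I‖ + |s| + α := by
    calc ‖z‖ = ‖(z - s + α * Complex.I) + s - α * Complex.I‖ := by congr 1; ring
      _ ≤ _ := by
        refine (norm_sub_le _ _).trans (add_le_add ((norm_add_le _ _).trans ?_) ?_)
        · simp
        · simp [abs_of_nonneg hα]
  have h3 : 1 + |s| + α ≤ (1 + |s| + α) / η * ‖z - s + α * Complex.I‖ := by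
    rw [div_mul_eq_mul_div, le_div_iff₀ hη]
    gcongr
  linarith

/-- Both poles, x - iε and -iδ, lie below the real axis and the integrand decays quadratically. -/
theorem integral_inv_mul_inv_eq_zero {ε δ : ℝ} (hε : 0 < ε) (hδ : 0 < δ) (x : ℝ) :
    Integrable (fun y : ℝ => ((y - x + ε * Complex.I) * (y + δ * Complex.I) : ℂ)⁻¹) volume ∧
    ∫ y : ℝ, ((y - x + ε * Complex.I) * (y + δ * Complex.I) : ℂ)⁻¹ = 0 := by
  -- Cauchy's theorem is available on a line of positive height, so everything is translated up by
  -- η; η < min ε δ keeps the shifted poles below the real axis.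
  obtain ⟨η, hη, hηε, hηδ⟩ : ∃ η, 0 < η ∧ η < ε ∧ η < δ :=
    ⟨min ε δ / 2, by positivity, by have := min_le_left ε δ; linarith,
      by have := min_le_right ε δ; linarith⟩
  set K := (1 + |x| + (ε - η)) / η + 1
  set L := (1 + |(0 : ℝ)| + (δ - η)) / η + 1
  have h := integral_horizontal_eq_zero
    (G := fun z => ((z - x + (ε - η : ℝ) * Complex.I) * (z + (δ - η : ℝ) * Complex.I))⁻¹)
    (p := 2) (C := K * L) (ε := η) (by norm_num) hη ?_ ?_
  · convert h using 5 <;> push_cast <;> ring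
  · intro z hz
    have hz : 0 < z.im := hz
    refine DifferentiableAt.differentiableWithinAt (DifferentiableAt.inv (by fun_prop) ?_)
    refine mul_ne_zero (fun h => ?_) (fun h => ?_)
    · have := congrArg Complex.im h
      simp at this
      linarith
    · have := congrArg Complex.im h
      simp at this
      linarith
  · intro z hz
    have h1 := one_add_norm_le_mul_norm_sub hη (sub_pos.2 hηε).le hz x
    have h2 := one_add_norm_le_mul_norm_sub hη (sub_pos.2 hηδ).le hz 0
    rw [Complex.ofReal_zero, sub_zero] at h2
    rw [norm_inv, norm_mul, Real.rpow_neg (by positivity), ← div_eq_mul_inv]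
    have h0 : 0 < 1 + ‖z‖ := by positivity
    have hp1 := h0.trans_le h1
    have hp2 := h0.trans_le h2
    have hK : 0 < K := by have := sub_pos.2 hηε; positivity
    have hL : 0 < L := by have := sub_pos.2 hηδ; positivity
    have hn1 := pos_of_mul_pos_right hp1 hK.le
    have hn2 := pos_of_mul_pos_right hp2 hL.le
    rw [inv_eq_one_div, div_le_div_iff₀ (by positivity) (by positivity), one_mul, Real.rpow_two]
    calc (1 + ‖z‖) ^ 2 = (1 + ‖z‖) * (1 + ‖z‖) := sq _
      _ ≤ _ := mul_le_mul h1 h2 h0.le hp1.le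
      _ = _ := by ring

theorem poissonKer_conv_inv {ε δ : ℝ} (hε : 0 < ε) (hδ : 0 < δ) (x : ℝ) :
    Integrable (fun y : ℝ => (poissonKer ε (x - y) : ℂ) * (y + δ * Complex.I)⁻¹) volume ∧
    ∫ y : ℝ, (poissonKer ε (x - y) : ℂ) * (y + δ * Complex.I)⁻¹ =
      (x + (ε + δ : ℝ) * Complex.I)⁻¹ := by
  obtain ⟨hi, h0⟩ := integral_inv_mul_inv_eq_zero hε hδ x
  have hp := integral_poissonKer hε
  have hne : ∀ y s : ℝ, s ≠ 0 → (y + s * Complex.I : ℂ) ≠ 0 := fun y s hs h => by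
    have := congrArg Complex.im h
    simp at this
    exact hs this
  set D : ℂ := x + (ε + δ : ℝ) * Complex.I with hD
  have hD0 : D ≠ 0 := hne _ _ (by positivity)
  have hpi : Integrable (fun y : ℝ => (poissonKer ε (x - y) : ℂ)) volume :=
    (hp.1.comp_sub_left x).ofReal
  -- D is the value of y + iδ at y = x + iε, the upper pole of the Poisson kernel. Subtracting D⁻¹
  -- from (y + iδ)⁻¹ cancels that pole and leaves a function whose poles are all below the axis.
  have e : (fun y : ℝ => (poissonKer ε (x - y) : ℂ) * (y + δ * Complex.I)⁻¹) = fun y : ℝ =>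
      D⁻¹ * (poissonKer ε (x - y) : ℂ) -
      (ε / Real.pi * D⁻¹ : ℂ) * ((y - x + ε * Complex.I) * (y + δ * Complex.I) : ℂ)⁻¹ := by
    ext y
    have h1 : (y + δ * Complex.I : ℂ) ≠ 0 := hne _ _ hδ.ne'
    have h2 : (y - x + ε * Complex.I : ℂ) ≠ 0 := by
      have := hne (y - x) _ hε.ne'
      rwa [Complex.ofReal_sub] at this
    have h3 : (y - x - ε * Complex.I : ℂ) ≠ 0 := by
      have := hne (y - x) (-ε) (neg_ne_zero.2 hε.ne')
      rwa [Complex.ofReal_sub, Complex.ofReal_neg, neg_mul, ← sub_eq_add_neg] at this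
    have hπ : (Real.pi : ℂ) ≠ 0 := by exact_mod_cast Real.pi_ne_zero
    have h4 : (poissonKer ε (x - y) : ℂ) =
        ε / (Real.pi * ((y - x + ε * Complex.I) * (y - x - ε * Complex.I))) := by
      rw [poissonKer]
      push_cast
      congr 2
      linear_combination ((ε : ℂ) ^ 2) * Complex.I_sq
    rw [h4]
    set E : ℂ := y + δ * Complex.I with hE
    set A : ℂ := y - x + ε * Complex.I with hA
    set B : ℂ := y - x - ε * Complex.I with hB
    field_simp
    rw [hD, hE, hB]
    push_cast
    ring
  rw [e]
  refine ⟨(hpi.const_mul _).sub (hi.const_mul _), ?_⟩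
  rw [integral_sub (hpi.const_mul _) (hi.const_mul _), integral_const_mul, integral_const_mul, h0,
    integral_complex_ofReal, integral_sub_left_eq_self (poissonKer ε), hp.2]
  simp

theorem conjPoissonKer_eq_re (δ : ℝ) (y : ℝ) :
    conjPoissonKer δ y = Real.pi⁻¹ * (((y + δ * Complex.I : ℂ)⁻¹).re) := by
  rw [conjPoissonKer, Complex.inv_re, Complex.normSq_apply]
  simp
  rw [mul_comm Real.pi, ← div_div, div_eq_mul_inv _ Real.pi, mul_comm, sq, sq]

theorem poissonKer_conv_conjPoissonKer {ε δ : ℝ} (hε : 0 < ε) (hδ : 0 < δ) (x : ℝ) :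
    ∫ y, poissonKer ε (x - y) * conjPoissonKer δ y = conjPoissonKer (ε + δ) x := by
  obtain ⟨hi, h⟩ := poissonKer_conv_inv hε hδ x
  have := integral_re hi
  rw [conjPoissonKer_eq_re, ← h]
  simp only [RCLike.re_eq_complex_re, Complex.re_ofReal_mul] at this
  rw [← this, ← integral_const_mul]
  congr 1
  ext y
  rw [conjPoissonKer_eq_re]
  ring

theorem conjPoissonKer_conv_poissonKer {ε δ : ℝ} (hε : 0 < ε) (hδ : 0 < δ) (x : ℝ) :
    ∫ y, conjPoissonKer ε (x - y) * poissonKer δ y = conjPoissonKer (ε + δ) x := by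
  rw [add_comm, ← poissonKer_conv_conjPoissonKer hδ hε x, ← integral_sub_left_eq_self _ _ x]
  simp only [sub_sub_cancel, mul_comm]

theorem poisson_conjPoisson {ε δ : ℝ} (hε : 0 < ε) (hδ : 0 < δ) {p : ℝ} (hp : 1 < p) {f : ℝ → ℂ}
    (hf : MemLp f (ENNReal.ofReal p) volume) :
    kconv (poissonKer ε) (kconv (conjPoissonKer δ) f) = kconv (conjPoissonKer (ε + δ)) f := by
  ext x
  have hb := kernelBound_conjPoissonKer hδ
  refine kconv_kconv (measurable_poissonKer ε) hb.measurable
    (poissonKer_conv_conjPoissonKer hε hδ) hf.1 ?_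
  refine lt_of_le_of_lt (lintegral_mono fun y =>
    mul_le_mul_right (hb.lintegral_mul_le hp hf.1 y) _) ?_
  rw [lintegral_mul_const' _ _ (ENNReal.mul_lt_top
    (hb.memLp (Real.HolderConjugate.conjExponent hp).symm.lt).2 hf.2).ne]
  exact ENNReal.mul_lt_top ((integral_poissonKer hε).1.comp_sub_left x).2 (ENNReal.mul_lt_top
    (hb.memLp (Real.HolderConjugate.conjExponent hp).symm.lt).2 hf.2)

/-- The outer kernel is not integrable, so absolute convergence comes from Hölder: the conjugate
kernel is in L^q with q conjugate to p, and the Poisson integral of |f| is in L^p. -/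
theorem conjPoisson_poisson {ε δ : ℝ} (hε : 0 < ε) (hδ : 0 < δ) {p : ℝ} (hp : 1 < p) {f : ℝ → ℂ}
    (hf : MemLp f (ENNReal.ofReal p) volume) :
    kconv (conjPoissonKer ε) (kconv (poissonKer δ) f) = kconv (conjPoissonKer (ε + δ)) f := by
  ext x
  have hb := kernelBound_conjPoissonKer hε
  have hpq := Real.HolderConjugate.conjExponent hp
  refine kconv_kconv hb.measurable (measurable_poissonKer δ)
    (conjPoissonKer_conv_poissonKer hε hδ) hf.1 ?_
  have hm : Measurable fun y => conjPoissonKer ε (x - y) := hb.measurable.comp (by fun_prop)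
  have hF : AEStronglyMeasurable
      (fun z : ℝ × ℝ => (poissonKer δ (z.1 - z.2) : ℂ) * f z.2) (volume.prod volume) :=
    (Complex.measurable_ofReal.comp ((measurable_poissonKer δ).comp
      (by fun_prop : Measurable fun z : ℝ × ℝ => z.1 - z.2))).aestronglyMeasurable.mul hf.1.comp_snd
  have hmem : MemLp (fun y => conjPoissonKer ε (x - y)) (ENNReal.ofReal p.conjExponent) volume :=
    (hb.memLp hpq.symm.lt).comp_measurePreserving (volume.measurePreserving_sub_left x)
  refine lt_of_le_of_lt (ENNReal.lintegral_mul_le_Lp_mul_Lq volume hpq.symm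
    (f := fun y => ‖conjPoissonKer ε (x - y)‖ₑ)
    (g := fun y => ∫⁻ z, ‖(poissonKer δ (y - z) : ℂ) * f z‖ₑ) hm.enorm.aemeasurable
    hF.enorm.lintegral_prod_right') ?_
  refine ENNReal.mul_lt_top ?_ ?_
  · have := hmem.2
    rw [eLpNorm_eq_lintegral_rpow_enorm_toReal (by simp [hpq.symm.pos]) (by simp),
      ENNReal.toReal_ofReal hpq.symm.nonneg] at this
    exact this
  · refine ENNReal.rpow_lt_top_of_nonneg (by positivity) (ne_of_lt ?_)
    refine (lintegral_poisson_rpow_le hδ hp hf.1).trans_lt ?_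
    rw [lintegral_rpow_eq_eLpNorm_rpow f hp]
    exact ENNReal.rpow_lt_top_of_nonneg (by linarith) hf.2.ne

/-! ### M. Riesz's theorem: uniform L^p bounds for conjugate Poisson integrals -/

/-- Near |θ| = π/2, cos(pθ) is close to cos(pπ/2), which is negative because 1 < p ≤ 2, so the B
term suffices. Elsewhere cos θ is bounded below and the A term dominates. -/
theorem exists_one_le_cos_rpow_sub {p : ℝ} (hp : 1 < p) (hp2 : p ≤ 2) :
    ∃ A B : ℝ, 0 ≤ A ∧ 0 ≤ B ∧ ∀ θ : ℝ, |θ| ≤ Real.pi / 2 →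
      1 ≤ A * Real.cos θ ^ p - B * Real.cos (θ * p) := by
  have hπ := Real.pi_pos
  set c := -Real.cos (Real.pi / 2 * p) with hc
  have hc0 : 0 < c := by
    have : Real.cos (Real.pi / 2 * p) < 0 :=
      Real.cos_neg_of_pi_div_two_lt_of_lt (by nlinarith) (by nlinarith)
    linarith
  set K := Real.pi / 2 * p with hK
  have hK0 : 0 < K := by positivity
  -- B = 2/c gives a gain of 1 where 2K cos θ ≤ c, since there cos(pθ) ≤ -c/2. Where 2K cos θ > c,
  -- (2K cos θ / c)^p is at least 1, and the factor 1 + 2/c pays for the worst loss B.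
  refine ⟨(1 + 2 / c) * (2 * K / c) ^ p, 2 / c, by positivity, by positivity, ?_⟩
  suffices H : ∀ θ : ℝ, 0 ≤ θ → θ ≤ Real.pi / 2 →
      1 ≤ (1 + 2 / c) * (2 * K / c) ^ p * Real.cos θ ^ p - 2 / c * Real.cos (θ * p) by
    intro θ hθ
    have := H |θ| (abs_nonneg _) hθ
    rwa [Real.cos_abs, ← abs_of_pos (show 0 < p by linarith), ← abs_mul, Real.cos_abs,
      abs_of_pos (show 0 < p by linarith)] at this
  intro θ h0 h1
  have hcos0 : 0 ≤ Real.cos θ := Real.cos_nonneg_of_mem_Icc ⟨by linarith, h1⟩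
  have hj : Real.pi / 2 - θ ≤ Real.pi / 2 * Real.cos θ := by
    have := Real.mul_le_sin (x := Real.pi / 2 - θ) (by linarith) (by linarith)
    rw [Real.sin_pi_div_two_sub, div_mul_eq_mul_div, div_le_iff₀ hπ] at this
    linarith
  have hl : Real.cos (θ * p) ≤ -c + K * Real.cos θ := by
    have h2 : |Real.cos (θ * p) - Real.cos K| ≤ |θ * p - K| := Real.abs_cos_sub_cos_le _ _
    have h3 : |θ * p - K| = (Real.pi / 2 - θ) * p := by
      rw [abs_of_nonpos (by nlinarith)]
      ring
    have h4 := (le_abs_self _).trans h2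
    rw [h3] at h4
    have h5 : (Real.pi / 2 - θ) * p ≤ Real.pi / 2 * Real.cos θ * p := by gcongr
    rw [hc]
    nlinarith
  by_cases hs : 2 * K * Real.cos θ ≤ c
  · have h6 : Real.cos (θ * p) ≤ -(c / 2) := by linarith
    have h7 : 2 / c * Real.cos (θ * p) ≤ 2 / c * -(c / 2) := by gcongr
    have h8 : 2 / c * -(c / 2) = -1 := by field_simp
    have : 0 ≤ (1 + 2 / c) * (2 * K / c) ^ p * Real.cos θ ^ p := by positivity
    linarith
  · have h6 : 1 ≤ (2 * K / c * Real.cos θ) ^ p := by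
      refine Real.one_le_rpow ?_ (by linarith)
      rw [div_mul_eq_mul_div, le_div_iff₀ hc0]
      linarith
    rw [Real.mul_rpow (by positivity) hcos0] at h6
    have h7 : 2 / c * Real.cos (θ * p) ≤ 2 / c * 1 := by
      gcongr
      exact Real.cos_le_one _
    have h8 : (1 + 2 / c) * 1 ≤ (1 + 2 / c) * ((2 * K / c) ^ p * Real.cos θ ^ p) := by gcongr
    linarith

/-- The trigonometric inequality scaled by ‖z‖^p. For z = F(x + iε) with F = u + iv holomorphic and
decaying, the last term integrates to 0 by Cauchy, which leaves ∫|v|^p ≤ A∫u^p. -/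
theorem exists_abs_im_rpow_le {p : ℝ} (hp : 1 < p) (hp2 : p ≤ 2) :
    ∃ A B : ℝ, 0 ≤ A ∧ 0 ≤ B ∧ ∀ z : ℂ, 0 ≤ z.re →
      |z.im| ^ p ≤ A * z.re ^ p - B * (z ^ (p : ℂ)).re := by
  obtain ⟨A, B, hA, hB, h⟩ := exists_one_le_cos_rpow_sub hp hp2
  refine ⟨A, B, hA, hB, fun z hz => ?_⟩
  have h1 : |z.arg| ≤ Real.pi / 2 := Complex.abs_arg_le_pi_div_two_iff.2 hz
  have h2 := h _ h1
  have hc : 0 ≤ Real.cos z.arg := Real.cos_nonneg_of_mem_Icc (abs_le.1 h1)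
  rw [Complex.cpow_ofReal_re]
  conv_lhs => rw [← Complex.norm_mul_sin_arg z]
  conv_rhs => rw [← Complex.norm_mul_cos_arg z]
  rw [Real.mul_rpow (norm_nonneg _) hc, abs_mul, abs_norm,
    Real.mul_rpow (norm_nonneg _) (abs_nonneg _)]
  have h3 : |Real.sin z.arg| ^ p ≤ 1 :=
    Real.rpow_le_one (abs_nonneg _) (Real.abs_sin_le_one _) (by linarith)
  calc ‖z‖ ^ p * |Real.sin z.arg| ^ p ≤ ‖z‖ ^ p * (A * Real.cos z.arg ^ p - B * Real.cos (z.arg * p)) := by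
        gcongr
        linarith
    _ = _ := by ring

/-- The holomorphic function on the upper half plane whose real part is the Poisson extension
of `f`. -/
noncomputable def poissonHol (f : ℝ → ℝ) (z : ℂ) : ℂ :=
  ∫ y : ℝ, (f y : ℂ) * (Complex.I / Real.pi * (z - y)⁻¹)

theorem sub_ofReal_ne_zero {z : ℂ} (hz : 0 < z.im) (y : ℝ) : z - y ≠ 0 := fun h => by
  have := congrArg Complex.im h
  simp at this
  exact hz.ne' this

theorem im_le_norm_sub_ofReal (z : ℂ) (y : ℝ) : z.im ≤ ‖z - y‖ := by
  have := (le_abs_self _).trans (Complex.abs_im_le_norm (z - y))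
  simpa using this

theorem norm_inv_sub_ofReal_le {z : ℂ} {η : ℝ} (hη : 0 < η) (hz : η ≤ z.im) (y : ℝ) :
    ‖(z - y)⁻¹‖ ≤ η⁻¹ := by
  rw [norm_inv]
  exact inv_anti₀ hη (hz.trans (im_le_norm_sub_ofReal z y))

theorem I_div_pi_mul_inv_eq (x y ε : ℝ) (hε : 0 < ε) :
    Complex.I / Real.pi * ((x + ε * Complex.I : ℂ) - y)⁻¹ =
      poissonKer ε (x - y) + conjPoissonKer ε (x - y) * Complex.I := by
  have h1 : (x + ε * Complex.I : ℂ) - y ≠ 0 := sub_ofReal_ne_zero (by simpa using hε) y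
  have h2 : ((x - y) ^ 2 + ε ^ 2 : ℂ) ≠ 0 := by
    have : (x - y) ^ 2 + ε ^ 2 ≠ 0 := by positivity
    exact_mod_cast this
  have hπ : (Real.pi : ℂ) ≠ 0 := by exact_mod_cast Real.pi_ne_zero
  rw [poissonKer, conjPoissonKer]
  push_cast
  set E : ℂ := (x + ε * Complex.I : ℂ) - y with hE
  field_simp
  rw [hE]
  linear_combination (-(ε : ℂ) * (x - y)) * Complex.I_sq

theorem differentiableOn_poissonHol {f : ℝ → ℝ} (hf : Integrable f volume) :
    DifferentiableOn ℂ (poissonHol f) {z | 0 < z.im} := by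
  intro z hz
  have hz : 0 < z.im := hz
  have hπ := Real.pi_pos
  have hm : ∀ w : ℂ, AEStronglyMeasurable
      (fun y : ℝ => (f y : ℂ) * (Complex.I / Real.pi * (w - y)⁻¹)) volume := fun w =>
    hf.ofReal.aestronglyMeasurable.mul (by fun_prop : Measurable fun y : ℝ =>
      Complex.I / Real.pi * (w - y)⁻¹).aestronglyMeasurable
  have hb : ∀ w ∈ {w : ℂ | z.im / 2 < w.im}, ∀ y : ℝ, ‖(w - y)⁻¹‖ ≤ (z.im / 2)⁻¹ :=
    fun w hw y => norm_inv_sub_ofReal_le (by positivity) (le_of_lt hw) y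
  have hcI : ‖(Complex.I / Real.pi : ℂ)‖ = Real.pi⁻¹ := by simp [abs_of_pos hπ]
  have hcI' : ‖(-(Complex.I / Real.pi) : ℂ)‖ = Real.pi⁻¹ := by rw [norm_neg, hcI]
  refine (hasDerivAt_integral_of_dominated_loc_of_deriv_le
    (F := fun (w : ℂ) (y : ℝ) => (f y : ℂ) * (Complex.I / Real.pi * (w - y)⁻¹))
    (F' := fun (w : ℂ) (y : ℝ) => (f y : ℂ) * (-(Complex.I / Real.pi) * ((w - y)⁻¹) ^ 2))
    (bound := fun y => |f y| * (Real.pi⁻¹ * ((z.im / 2)⁻¹) ^ 2))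
    (s := {w : ℂ | z.im / 2 < w.im}) ?_ (Eventually.of_forall hm) ?_ ?_ ?_ ?_ ?_).2.differentiableAt.differentiableWithinAt
  · exact (isOpen_lt continuous_const Complex.continuous_im).mem_nhds (by
      show z.im / 2 < z.im
      linarith)
  · refine Integrable.mono' (hf.norm.mul_const (Real.pi⁻¹ * (z.im / 2)⁻¹)) (hm z)
      (ae_of_all _ fun y => ?_)
    rw [norm_mul, norm_mul, hcI, Complex.norm_real]
    gcongr
    exact hb z (by show z.im / 2 < z.im; linarith) y
  · exact hf.ofReal.aestronglyMeasurable.mul (by fun_prop : Measurable fun y : ℝ =>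
      -(Complex.I / Real.pi) * ((z - y)⁻¹) ^ 2).aestronglyMeasurable
  · refine ae_of_all _ fun y w hw => ?_
    rw [norm_mul, norm_mul, hcI', Complex.norm_real, norm_pow, Real.norm_eq_abs]
    gcongr
    exact hb w hw y
  · exact hf.abs.mul_const _
  · refine ae_of_all _ fun y w hw => ?_
    have hw : z.im / 2 < w.im := hw
    have h1 : HasDerivAt (fun w : ℂ => (w - y)⁻¹) (-1 / (w - y) ^ 2) w :=
      ((hasDerivAt_id w).sub_const (y : ℂ)).inv
        (sub_ofReal_ne_zero (z := w) (by linarith) y)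
    refine ((h1.const_mul (Complex.I / Real.pi)).const_mul (f y : ℂ)).congr_deriv ?_
    rw [inv_pow]
    ring

theorem ofReal_integral_kernel_mul (K : ℝ → ℝ) (f : ℝ → ℝ) (x : ℝ) :
    kconv K (fun y => (f y : ℂ)) x = ((∫ y, K (x - y) * f y : ℝ) : ℂ) := by
  rw [kconv, ← integral_complex_ofReal]
  simp

theorem poissonHol_eq {f : ℝ → ℝ} {p : ℝ} (hp : 1 < p)
    (hf : MemLp (fun y => (f y : ℂ)) (ENNReal.ofReal p) volume) (x : ℝ) {ε : ℝ} (hε : 0 < ε) :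
    poissonHol f (x + ε * Complex.I) = ((∫ y, poissonKer ε (x - y) * f y : ℝ) : ℂ) +
      ((∫ y, conjPoissonKer ε (x - y) * f y : ℝ) : ℂ) * Complex.I := by
  rw [← ofReal_integral_kernel_mul, ← ofReal_integral_kernel_mul, kconv, kconv,
    ← integral_mul_const, ← integral_add, poissonHol]
  · congr 1
    ext y
    rw [I_div_pi_mul_inv_eq x y ε hε]
    ring
  · exact (kernelBound_poissonKer hε).integrable_mul hp hf x
  · exact ((kernelBound_conjPoissonKer hε).integrable_mul hp hf x).mul_const _

/-- Compact support yields decay of order 1/‖z‖; its p-th power then satisfies the hypothesis of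
Cauchy's theorem exactly because p > 1. -/
theorem exists_norm_poissonHol_le {f : ℝ → ℝ} (hf : Integrable f volume) {R : ℝ} (hR : 0 ≤ R)
    (hsupp : ∀ y, R < |y| → f y = 0) {ε : ℝ} (hε : 0 < ε) :
    ∃ C, 0 ≤ C ∧ ∀ z : ℂ, ε ≤ z.im → ‖poissonHol f z‖ ≤ C * (1 + ‖z‖)⁻¹ := by
  have hπ := Real.pi_pos
  set L := (1 + R) / ε + 1 with hL
  have hL0 : 0 < L := by positivity
  refine ⟨(∫ y, |f y|) * (Real.pi⁻¹ * L), ?_, fun z hz => ?_⟩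
  · have : 0 ≤ ∫ y, |f y| := integral_nonneg fun _ => abs_nonneg _
    positivity
  have hcI : ‖(Complex.I / Real.pi : ℂ)‖ = Real.pi⁻¹ := by simp [abs_of_pos hπ]
  have h1 : ∀ y, ‖(f y : ℂ) * (Complex.I / Real.pi * (z - y)⁻¹)‖ ≤
      |f y| * (Real.pi⁻¹ * L * (1 + ‖z‖)⁻¹) := by
    intro y
    rw [norm_mul, norm_mul, hcI, Complex.norm_real, Real.norm_eq_abs]
    by_cases hy : R < |y|
    · simp [hsupp y hy]
    · have h2 := one_add_norm_le_mul_norm_sub hε le_rfl hz y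
      simp only [Complex.ofReal_zero, zero_mul, add_zero] at h2
      have hpos : 0 < ‖z - y‖ := norm_pos_iff.2 (sub_ofReal_ne_zero (by linarith) y)
      have h3 : 1 + ‖z‖ ≤ L * ‖z - y‖ := by
        refine h2.trans ?_
        rw [hL]
        gcongr
        exact not_lt.1 hy
      rw [mul_assoc Real.pi⁻¹, norm_inv]
      gcongr
      rw [← div_eq_mul_inv, le_div_iff₀ (by positivity), inv_mul_le_iff₀ hpos, mul_comm]
      exact h3
  calc ‖poissonHol f z‖ ≤ ∫ y, |f y| * (Real.pi⁻¹ * L * (1 + ‖z‖)⁻¹) :=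
        norm_integral_le_of_norm_le (hf.abs.mul_const _) (ae_of_all _ h1)
    _ = _ := by rw [integral_mul_const]; ring

theorem memLp_of_bounded_of_compactSupport {f : ℝ → ℂ} (hm : AEStronglyMeasurable f volume)
    {M R : ℝ} (hM : ∀ y, ‖f y‖ ≤ M) (hsupp : ∀ y, R < |y| → f y = 0) (q : ℝ≥0∞) :
    MemLp f q volume := by
  have h1 : MemLp ((Icc (-R) R).indicator fun _ => M) q volume :=
    memLp_indicator_const q measurableSet_Icc M (Or.inr (by simp))
  refine h1.mono' hm (ae_of_all _ fun y => ?_)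
  by_cases hy : y ∈ Icc (-R) R
  · rw [indicator_of_mem hy]
    exact hM y
  · rw [indicator_of_notMem hy, hsupp y, norm_zero]
    by_contra h
    exact hy (abs_le.1 (not_lt.1 h))

/-- M. Riesz' inequality for nonnegative bounded functions of compact support, `1 < p ≤ 2`. -/
theorem exists_conjPoisson_bound_nonneg {p : ℝ} (hp : 1 < p) (hp2 : p ≤ 2) :
    ∃ A : ℝ, 0 ≤ A ∧ ∀ f : ℝ → ℝ, AEStronglyMeasurable f volume → (∀ y, 0 ≤ f y) →
      (∃ M, ∀ y, f y ≤ M) → (∃ R, 0 ≤ R ∧ ∀ y, R < |y| → f y = 0) → ∀ ε, 0 < ε →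
      ∫⁻ x, ‖kconv (conjPoissonKer ε) (fun y => (f y : ℂ)) x‖ₑ ^ p ≤
        ENNReal.ofReal A * ∫⁻ x, ‖(f x : ℂ)‖ₑ ^ p := by
  obtain ⟨A, B, hA, hB, hAB⟩ := exists_abs_im_rpow_le hp hp2
  refine ⟨A, hA, ?_⟩
  rintro f hfm hf0 ⟨M, hM⟩ ⟨R, hR, hsupp⟩ ε hε
  -- Away from this trivial case u is strictly positive, so `poissonHol f` maps the upper half plane
  -- into the right half plane, where the p-th power is holomorphic.
  by_cases hzero : f =ᵐ[volume] 0
  · have h0 : (fun y => (f y : ℂ)) =ᵐ[volume] fun _ => 0 := hzero.mono fun y hy => by simp [hy]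
    rw [kconv_congr_ae _ h0]
    simp [kconv, show 0 < p by linarith]
  have hfc : ∀ q, MemLp (fun y => (f y : ℂ)) q volume := fun q =>
    memLp_of_bounded_of_compactSupport (Complex.continuous_ofReal.comp_aestronglyMeasurable hfm)
      (M := M) (R := R) (fun y => by simpa [abs_of_nonneg (hf0 y)] using hM y)
      (fun y hy => by simp [hsupp y hy]) q
  have hfi : Integrable f volume := by
    have := (memLp_one_iff_integrable.1 (hfc 1)).re
    simpa using this
  have hp0 : 0 < p := by linarith
  set u : ℝ → ℝ → ℝ := fun δ x => ∫ y, poissonKer δ (x - y) * f y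
  set v : ℝ → ℝ → ℝ := fun δ x => ∫ y, conjPoissonKer δ (x - y) * f y
  have hF : ∀ x δ : ℝ, 0 < δ → poissonHol f (x + δ * Complex.I) = u δ x + v δ x * Complex.I :=
    fun x δ hδ => poissonHol_eq hp (hfc _) x hδ
  have hpos : ∀ x δ : ℝ, 0 < δ → 0 < u δ x := by
    intro x δ hδ
    have hi : Integrable (fun y => poissonKer δ (x - y) * f y) volume := by
      have := ((kernelBound_poissonKer hδ).integrable_mul hp (hfc _) x).re
      simpa using this
    refine lt_of_le_of_ne (integral_nonneg fun y => mul_nonneg (poissonKer_nonneg hδ _) (hf0 y)) ?_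
    intro h
    have h1 := (integral_eq_zero_iff_of_nonneg
      (fun y => mul_nonneg (poissonKer_nonneg hδ _) (hf0 y)) hi).1 h.symm
    refine hzero (h1.mono fun y hy => ?_)
    exact (mul_eq_zero.1 hy).resolve_left (poissonKer_pos hδ _).ne'
  have hre : ∀ z : ℂ, 0 < z.im → 0 < (poissonHol f z).re := by
    intro z hz
    have := hF z.re z.im hz
    rw [Complex.re_add_im] at this
    rw [this]
    simpa using hpos z.re z.im hz
  obtain ⟨C, hC, hdec⟩ := exists_norm_poissonHol_le hfi hR hsupp hε
  obtain ⟨hGi, hG0⟩ := integral_horizontal_eq_zero (G := fun z => poissonHol f z ^ (p : ℂ))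
    (p := p) (C := C ^ p) hp hε
    (fun z hz => ((differentiableOn_poissonHol hfi) z hz).cpow_const (Or.inl (hre z hz)))
    (fun z hz => by
      rw [Complex.norm_cpow_real, Real.rpow_neg (by positivity), ← Real.inv_rpow (by positivity),
        ← Real.mul_rpow hC (by positivity)]
      exact Real.rpow_le_rpow (norm_nonneg _) (hdec z hz) hp0.le)
  set G : ℝ → ℂ := fun x => poissonHol f (x + ε * Complex.I) ^ (p : ℂ) with hG
  have hu_meas : AEStronglyMeasurable (u ε) volume := by
    have h1 := (kernelBound_poissonKer hε).aestronglyMeasurable_kconv (hfc 1).1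
    have h2 := Complex.continuous_re.comp_aestronglyMeasurable h1
    refine h2.congr (ae_of_all _ fun x => ?_)
    simp only [ofReal_integral_kernel_mul, Complex.ofReal_re, u]
  have hui : Integrable (fun x => u ε x ^ p) volume := by
    refine Integrable.mono' hGi.norm ?_ (ae_of_all _ fun x => ?_)
    · exact (hu_meas.aemeasurable.pow_const p).aestronglyMeasurable
    · rw [Complex.norm_cpow_real, Real.norm_of_nonneg (Real.rpow_nonneg (hpos x ε hε).le _)]
      refine Real.rpow_le_rpow (hpos x ε hε).le ?_ hp0.le
      refine le_trans ?_ ((le_abs_self _).trans (Complex.abs_re_le_norm _))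
      rw [hF x ε hε]
      simp
  have hle : ∀ x, |v ε x| ^ p ≤ A * u ε x ^ p - B * (G x).re := by
    intro x
    have := hAB (poissonHol f (x + ε * Complex.I)) (hre _ (by simpa using hε)).le
    simpa [hG, hF x ε hε] using this
  have hGre : ∫ x, (G x).re = 0 := by
    have := integral_re hGi
    simp only [RCLike.re_eq_complex_re] at this
    rw [this, hG0, Complex.zero_re]
  have hGri : Integrable (fun x => (G x).re) volume := hGi.re
  have hsub : Integrable (fun x => A * u ε x ^ p - B * (G x).re) volume :=
    (hui.const_mul A).sub (hGri.const_mul B)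
  calc ∫⁻ x, ‖kconv (conjPoissonKer ε) (fun y => (f y : ℂ)) x‖ₑ ^ p
      = ∫⁻ x, ENNReal.ofReal (|v ε x| ^ p) := by
        refine lintegral_congr fun x => ?_
        rw [ofReal_integral_kernel_mul, enorm_ofReal_complex, Real.enorm_eq_ofReal_abs,
          ENNReal.ofReal_rpow_of_nonneg (abs_nonneg _) hp0.le]
    _ ≤ ∫⁻ x, ENNReal.ofReal (A * u ε x ^ p - B * (G x).re) :=
        lintegral_mono fun x => ENNReal.ofReal_le_ofReal (hle x)
    _ = ENNReal.ofReal (∫ x, (A * u ε x ^ p - B * (G x).re)) := by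
        rw [ofReal_integral_eq_lintegral_ofReal hsub]
        exact ae_of_all _ fun x => (Real.rpow_nonneg (abs_nonneg _) _).trans (hle x)
    _ = ENNReal.ofReal A * ∫⁻ x, ENNReal.ofReal (u ε x ^ p) := by
        rw [integral_sub (hui.const_mul A) (hGri.const_mul B), integral_const_mul,
          integral_const_mul, hGre, mul_zero, sub_zero, ENNReal.ofReal_mul hA,
          ofReal_integral_eq_lintegral_ofReal hui]
        exact ae_of_all _ fun x => Real.rpow_nonneg (hpos x ε hε).le _
    _ ≤ ENNReal.ofReal A * ∫⁻ x, ‖(f x : ℂ)‖ₑ ^ p := by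
        gcongr 1
        refine le_trans (lintegral_mono fun x => ?_) (lintegral_poisson_rpow_le hε hp (hfc 1).1)
        rw [← ENNReal.ofReal_rpow_of_nonneg (hpos x ε hε).le hp0.le]
        gcongr
        refine le_trans (le_of_eq ?_) (enorm_integral_le_lintegral_enorm _)
        have := ofReal_integral_kernel_mul (poissonKer ε) f x
        rw [kconv] at this
        rw [this, enorm_ofReal_complex, Real.enorm_of_nonneg (hpos x ε hε).le]

/-- Uniform bounds for the conjugate Poisson integrals on `L^p`. -/
def ConjPoissonBound (p : ℝ) : Prop :=
  ∃ A : ℝ≥0∞, A < ∞ ∧ ∀ f : ℝ → ℂ, MemLp f (ENNReal.ofReal p) volume → ∀ ε, 0 < ε →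
    eLpNorm (kconv (conjPoissonKer ε) f) (ENNReal.ofReal p) volume ≤
      A * eLpNorm f (ENNReal.ofReal p) volume

/-- Truncation in height and support reduces to the bounded, compactly supported case; dominated
convergence gives pointwise limits, and Fatou passes the bound on. -/
theorem exists_conjPoisson_bound_nonneg_memLp {p : ℝ} (hp : 1 < p) (hp2 : p ≤ 2) :
    ∃ A : ℝ≥0∞, A < ∞ ∧ ∀ f : ℝ → ℝ, (∀ y, 0 ≤ f y) →
      MemLp (fun y => (f y : ℂ)) (ENNReal.ofReal p) volume → ∀ ε, 0 < ε →
      eLpNorm (kconv (conjPoissonKer ε) (fun y => (f y : ℂ))) (ENNReal.ofReal p) volume ≤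
        A * eLpNorm (fun y => (f y : ℂ)) (ENNReal.ofReal p) volume := by
  obtain ⟨A, hA, h⟩ := exists_conjPoisson_bound_nonneg hp hp2
  have hp0 : 0 < p := by linarith
  refine ⟨ENNReal.ofReal A ^ (1 / p), ENNReal.rpow_lt_top_of_nonneg (by positivity) (by simp), ?_⟩
  intro f hf0 hf ε hε
  set g : ℕ → ℝ → ℝ := fun n => (Icc (-n : ℝ) n).indicator fun y => min (f y) n with hg
  have hfm : AEStronglyMeasurable f volume := by
    simpa using Complex.continuous_re.comp_aestronglyMeasurable hf.1
  have hgm : ∀ n, AEStronglyMeasurable (g n) volume := fun n =>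
    (hfm.inf aestronglyMeasurable_const).indicator measurableSet_Icc
  have hg0 : ∀ n y, 0 ≤ g n y := fun n y =>
    indicator_nonneg (fun y _ => le_min (hf0 y) (Nat.cast_nonneg n)) y
  have hgf : ∀ n y, g n y ≤ f y := fun n y =>
    indicator_le_self' (fun _ _ => hf0 _) y |>.trans' (indicator_le_indicator (min_le_left _ _))
  have hgn : ∀ n y, g n y ≤ n := fun n y => by
    simp only [hg, indicator_apply]
    split_ifs
    · exact min_le_right _ _
    · exact Nat.cast_nonneg n
  have hg_lim : ∀ y, Tendsto (fun n => g n y) atTop (𝓝 (f y)) := by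
    intro y
    obtain ⟨N, hN⟩ := exists_nat_ge (max |y| (f y))
    refine tendsto_const_nhds.congr' ?_
    filter_upwards [eventually_ge_atTop N] with n hn
    have hn' : (N : ℝ) ≤ n := by exact_mod_cast hn
    have h1 : |y| ≤ n := (le_max_left _ _).trans (hN.trans hn')
    have h2 : f y ≤ n := (le_max_right _ _).trans (hN.trans hn')
    rw [hg]
    simp only
    rw [indicator_of_mem (mem_Icc.2 (abs_le.1 h1)), min_eq_left h2]
  have hlim : ∀ x, Tendsto (fun n => kconv (conjPoissonKer ε) (fun y => (g n y : ℂ)) x) atTop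
      (𝓝 (kconv (conjPoissonKer ε) (fun y => (f y : ℂ)) x)) := by
    intro x
    have hb := kernelBound_conjPoissonKer hε
    refine tendsto_integral_of_dominated_convergence _ (fun n => ?_)
      (hb.integrable_mul hp hf x).norm (fun n => ae_of_all _ fun y => ?_) (ae_of_all _ fun y => ?_)
    · exact (Complex.measurable_ofReal.comp (hb.measurable.comp
        (by fun_prop : Measurable fun y => x - y))).aestronglyMeasurable.mul
        (Complex.continuous_ofReal.comp_aestronglyMeasurable (hgm n))
    · rw [norm_mul, norm_mul]
      gcongr
      rw [Complex.norm_real, Complex.norm_real, Real.norm_of_nonneg (hg0 n y),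
        Real.norm_of_nonneg (hf0 y)]
      exact hgf n y
    · exact ((Complex.continuous_ofReal.tendsto _).comp (hg_lim y)).const_mul _
  have hgc : ∀ n, AEStronglyMeasurable (fun y => (g n y : ℂ)) volume := fun n =>
    Complex.continuous_ofReal.comp_aestronglyMeasurable (hgm n)
  refine (Lp.eLpNorm_lim_le_liminf_eLpNorm (fun n =>
    (kernelBound_conjPoissonKer hε).aestronglyMeasurable_kconv (hgc n)) _
    (ae_of_all _ hlim)).trans ?_
  refine liminf_le_of_le (by isBoundedDefault) fun b hb => ?_
  obtain ⟨n, hn⟩ := hb.exists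
  refine hn.trans ((eLpNorm_le_of_lintegral_rpow_le hp
    (B := ENNReal.ofReal A ^ (1 / p) * eLpNorm (fun y => (g n y : ℂ)) (ENNReal.ofReal p) volume)
    ?_).trans ?_)
  · rw [ENNReal.mul_rpow_of_nonneg _ _ hp0.le, ← lintegral_rpow_eq_eLpNorm_rpow _ hp,
      ← ENNReal.rpow_mul, one_div_mul_cancel hp0.ne', ENNReal.rpow_one]
    refine h (g n) (hgm n) (hg0 n) ⟨n, hgn n⟩ ⟨n, Nat.cast_nonneg n, fun y hy => ?_⟩ ε hε
    exact indicator_of_notMem (fun hy' => hy.not_ge (abs_le.2 (mem_Icc.1 hy'))) _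
  · gcongr 1
    refine eLpNorm_mono fun y => ?_
    rw [Complex.norm_real, Complex.norm_real, Real.norm_of_nonneg (hg0 n y),
        Real.norm_of_nonneg (hf0 y)]
    exact hgf n y

theorem conjPoissonBound_of_le_two {p : ℝ} (hp : 1 < p) (hp2 : p ≤ 2) : ConjPoissonBound p := by
  obtain ⟨A, hA, h⟩ := exists_conjPoisson_bound_nonneg_memLp hp hp2
  have h1p : 1 ≤ ENNReal.ofReal p := by simpa using hp.le
  have hreal : ∀ f : ℝ → ℝ, MemLp f (ENNReal.ofReal p) volume → ∀ ε, 0 < ε →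
      eLpNorm (kconv (conjPoissonKer ε) (fun y => (f y : ℂ))) (ENNReal.ofReal p) volume ≤
        (A + A) * eLpNorm f (ENNReal.ofReal p) volume := by
    intro f hf ε hε
    have hb := kernelBound_conjPoissonKer hε
    have hpart : ∀ g : ℝ → ℝ, AEStronglyMeasurable g volume → (∀ y, 0 ≤ g y) →
        (∀ y, g y ≤ |f y|) → MemLp (fun y => (g y : ℂ)) (ENNReal.ofReal p) volume ∧
        eLpNorm (kconv (conjPoissonKer ε) (fun y => (g y : ℂ))) (ENNReal.ofReal p) volume ≤
          A * eLpNorm f (ENNReal.ofReal p) volume := by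
      intro g hgm hg0 hgf
      have hle : ∀ y, ‖(g y : ℂ)‖ ≤ ‖f y‖ := fun y => by
        rw [Complex.norm_real, Real.norm_of_nonneg (hg0 y)]
        exact hgf y
      have hg : MemLp (fun y => (g y : ℂ)) (ENNReal.ofReal p) volume :=
        hf.mono (Complex.continuous_ofReal.comp_aestronglyMeasurable hgm) (ae_of_all _ hle)
      refine ⟨hg, (h g hg0 hg ε hε).trans ?_⟩
      gcongr 1
      exact eLpNorm_mono hle
    obtain ⟨m1, b1⟩ := hpart (fun y => max (f y) 0) (hf.1.sup aestronglyMeasurable_const)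
      (fun y => le_max_right _ _) (fun y => max_le (le_abs_self _) (abs_nonneg _))
    obtain ⟨m2, b2⟩ := hpart (fun y => max (-f y) 0) (hf.1.neg.sup aestronglyMeasurable_const)
      (fun y => le_max_right _ _) (fun y => max_le (neg_le_abs _) (abs_nonneg _))
    have e : (fun y => (f y : ℂ)) =
        (fun y => ((max (f y) 0 : ℝ) : ℂ)) - fun y => ((max (-f y) 0 : ℝ) : ℂ) := by
      ext y
      rw [Pi.sub_apply, ← Complex.ofReal_sub]
      congr 1
      rcases le_total 0 (f y) with h0 | h0
      · rw [max_eq_left h0, max_eq_right (by linarith), sub_zero]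
      · rw [max_eq_right h0, max_eq_left (by linarith)]
        ring
    rw [e, hb.kconv_sub hp m1 m2, add_mul]
    exact (eLpNorm_sub_le (hb.aestronglyMeasurable_kconv m1.1)
      (hb.aestronglyMeasurable_kconv m2.1) h1p).trans (add_le_add b1 b2)
  refine ⟨(A + A) + (A + A), by simp [hA], fun f hf ε hε => ?_⟩
  have hb := kernelBound_conjPoissonKer hε
  have hre : MemLp (fun y => (f y).re) (ENNReal.ofReal p) volume := hf.re
  have him : MemLp (fun y => (f y).im) (ENNReal.ofReal p) volume := hf.im
  have hrec : MemLp (fun y => ((f y).re : ℂ)) (ENNReal.ofReal p) volume := hre.ofReal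
  have himc : MemLp (fun y => ((f y).im : ℂ)) (ENNReal.ofReal p) volume := him.ofReal
  have himc' : MemLp (fun y => Complex.I * ((f y).im : ℂ)) (ENNReal.ofReal p) volume :=
    himc.const_mul _
  have e : f = (fun y => ((f y).re : ℂ)) + fun y => Complex.I * ((f y).im : ℂ) := by
    ext y
    rw [Pi.add_apply, mul_comm, Complex.re_add_im]
  have e2 : kconv (conjPoissonKer ε) (fun y => Complex.I * ((f y).im : ℂ)) =
      Complex.I • kconv (conjPoissonKer ε) (fun y => ((f y).im : ℂ)) := by
    ext x
    rw [Pi.smul_apply, smul_eq_mul, kconv, kconv, ← integral_const_mul]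
    congr 1
    ext y
    ring
  have b1 := hreal _ hre ε hε
  have b2 := hreal _ him ε hε
  conv_lhs => rw [e]
  rw [hb.kconv_add hp hrec himc', add_mul]
  refine (eLpNorm_add_le (hb.aestronglyMeasurable_kconv hrec.1)
      (hb.aestronglyMeasurable_kconv himc'.1) h1p).trans (add_le_add ?_ ?_)
  · refine b1.trans ?_
    gcongr 1
    exact eLpNorm_mono fun y => Complex.abs_re_le_norm _
  · rw [e2, eLpNorm_const_smul]
    simp only [enorm_eq_nnnorm, Complex.nnnorm_I, ENNReal.coe_one, one_mul]
    refine b2.trans ?_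
    gcongr 1
    exact eLpNorm_mono fun y => Complex.abs_im_le_norm _

/-- The kernel is odd, so Q_ε is skew for the bilinear pairing. Fubini applies because h is
integrable and the inner absolute integrals are uniformly bounded. -/
theorem integral_mul_kconv_conjPoisson {ε : ℝ} (hε : 0 < ε) {p : ℝ} (hp : 1 < p) {f h : ℝ → ℂ}
    (hf : MemLp f (ENNReal.ofReal p) volume) (hh : Integrable h volume) :
    ∫ x, h x * kconv (conjPoissonKer ε) f x = -∫ z, f z * kconv (conjPoissonKer ε) h z := by
  have hb := kernelBound_conjPoissonKer hε
  have hm : Measurable fun z : ℝ × ℝ => conjPoissonKer ε (z.1 - z.2) :=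
    hb.measurable.comp (by fun_prop)
  have hF : AEStronglyMeasurable
      (fun z : ℝ × ℝ => h z.1 * ((conjPoissonKer ε (z.1 - z.2) : ℂ) * f z.2))
      (volume.prod volume) :=
    hh.1.comp_fst.mul
      ((Complex.measurable_ofReal.comp hm).aestronglyMeasurable.mul hf.1.comp_snd)
  have hc : eLpNorm (conjPoissonKer ε) (ENNReal.ofReal p.conjExponent) volume *
      eLpNorm f (ENNReal.ofReal p) volume < ∞ :=
    ENNReal.mul_lt_top (hb.memLp (Real.HolderConjugate.conjExponent hp).symm.lt).2 hf.2
  have hint : Integrable (fun z : ℝ × ℝ => h z.1 * ((conjPoissonKer ε (z.1 - z.2) : ℂ) * f z.2))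
      (volume.prod volume) := by
    refine ⟨hF, ?_⟩
    rw [HasFiniteIntegral, lintegral_prod _ hF.enorm]
    calc ∫⁻ x, ∫⁻ y, ‖h x * ((conjPoissonKer ε (x - y) : ℂ) * f y)‖ₑ
        = ∫⁻ x, ‖h x‖ₑ * ∫⁻ y, ‖(conjPoissonKer ε (x - y) : ℂ) * f y‖ₑ := by
          refine lintegral_congr fun x => ?_
          rw [← lintegral_const_mul' _ _ (by simp)]
          simp only [enorm_mul]
      _ ≤ ∫⁻ x, ‖h x‖ₑ * _ := lintegral_mono fun x =>
          mul_le_mul_right (hb.lintegral_mul_le hp hf.1 x) _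
      _ < ∞ := by
          rw [lintegral_mul_const' _ _ hc.ne]
          exact ENNReal.mul_lt_top hh.2 hc
  calc ∫ x, h x * kconv (conjPoissonKer ε) f x
      = ∫ x, ∫ y, h x * ((conjPoissonKer ε (x - y) : ℂ) * f y) := by
        simp only [kconv, integral_const_mul]
    _ = ∫ y, ∫ x, h x * ((conjPoissonKer ε (x - y) : ℂ) * f y) := integral_integral_swap hint
    _ = ∫ z, -(f z * kconv (conjPoissonKer ε) h z) := by
        congr 1
        ext z
        rw [kconv, ← integral_const_mul, ← integral_neg]
        congr 1
        ext x
        rw [← neg_sub z x, conjPoissonKer_neg]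
        push_cast
        ring
    _ = _ := integral_neg _

theorem enorm_integral_mul_le {p : ℝ} (hp : 1 < p) {f g : ℝ → ℂ}
    (hf : AEStronglyMeasurable f volume) (hg : AEStronglyMeasurable g volume) :
    ‖∫ x, f x * g x‖ₑ ≤ eLpNorm f (ENNReal.ofReal p) volume *
      eLpNorm g (ENNReal.ofReal p.conjExponent) volume := by
  have hpq := Real.HolderConjugate.conjExponent hp
  have hq := hpq.symm.lt
  rw [eLpNorm_eq_lintegral_rpow_enorm_toReal (by simp; linarith) (by simp),
    eLpNorm_eq_lintegral_rpow_enorm_toReal (by simp; linarith) (by simp),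
    ENNReal.toReal_ofReal (by linarith), ENNReal.toReal_ofReal (by linarith)]
  refine (enorm_integral_le_lintegral_enorm _).trans ?_
  simp only [enorm_mul]
  exact ENNReal.lintegral_mul_le_Lp_mul_Lq volume hpq hf.enorm hg.enorm

/-- Duality with the conjugate exponent q ≤ 2. The function g = Q_ε f is tested against
conj(G)|G|^(p-2), where G is g cut off to [-n, n]. -/
theorem conjPoissonBound_of_two_lt {p : ℝ} (hp2 : 2 < p) : ConjPoissonBound p := by
  have hp : 1 < p := by linarith
  have hp0 : 0 < p := by linarith
  have hpq := Real.HolderConjugate.conjExponent hp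
  set q := p.conjExponent with hq_def
  have hq1 : 1 < q := hpq.symm.lt
  have hq0 : 0 < q := by linarith
  have hq2 : q ≤ 2 := by
    rw [hq_def, Real.conjExponent, div_le_iff₀ (by linarith)]
    linarith
  have hmulq : (p - 1) * q = p := by
    rw [hq_def, Real.conjExponent]
    field_simp [show p - 1 ≠ 0 by linarith]
  obtain ⟨A, hA, hAb⟩ := conjPoissonBound_of_le_two hq1 hq2
  refine ⟨A, hA, fun f hf ε hε => ?_⟩
  have hb := kernelBound_conjPoissonKer hε
  set g := kconv (conjPoissonKer ε) f with hg_def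
  have hgm : AEStronglyMeasurable g volume := hb.aestronglyMeasurable_kconv hf.1
  obtain ⟨M, hM0, hM⟩ : ∃ M : ℝ, 0 ≤ M ∧ ∀ x, ‖g x‖ ≤ M := by
    have hc : eLpNorm (conjPoissonKer ε) (ENNReal.ofReal p.conjExponent) volume *
        eLpNorm f (ENNReal.ofReal p) volume < ∞ :=
      ENNReal.mul_lt_top (hb.memLp hq1).2 hf.2
    refine ⟨(eLpNorm (conjPoissonKer ε) (ENNReal.ofReal p.conjExponent) volume *
      eLpNorm f (ENNReal.ofReal p) volume).toReal, ENNReal.toReal_nonneg, fun x => ?_⟩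
    have := ENNReal.toReal_mono hc.ne (hb.enorm_kconv_le hp hf.1 x)
    rwa [toReal_enorm] at this
  -- The cutoff is needed since g is so far only known to be bounded: it makes the norm J of G
  -- finite, so J may be cancelled, and puts the test function in L^1 and L^q.
  set G : ℕ → ℝ → ℂ := fun n => (Icc (-n : ℝ) n).indicator g with hG
  have hGm : ∀ n, AEStronglyMeasurable (G n) volume := fun n => hgm.indicator measurableSet_Icc
  have hGM : ∀ n y, ‖G n y‖ ≤ M := fun n y => (norm_indicator_le_norm_self _ _).trans (hM y)
  have hGsupp : ∀ (n : ℕ) y, (n : ℝ) < |y| → G n y = 0 := fun n y hy =>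
    indicator_of_notMem (fun hy' => hy.not_ge (abs_le.2 (mem_Icc.1 hy'))) _
  have hG_lim : ∀ y, Tendsto (fun n => G n y) atTop (𝓝 (g y)) := by
    intro y
    obtain ⟨N, hN⟩ := exists_nat_ge |y|
    refine tendsto_const_nhds.congr' ?_
    filter_upwards [eventually_ge_atTop N] with n hn
    have hn' : (N : ℝ) ≤ n := by exact_mod_cast hn
    exact (indicator_of_mem (mem_Icc.2 (abs_le.1 (hN.trans hn'))) _).symm
  refine (Lp.eLpNorm_lim_le_liminf_eLpNorm hGm _ (ae_of_all _ hG_lim)).trans ?_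
  refine liminf_le_of_le (by isBoundedDefault) fun b hb' => ?_
  obtain ⟨n, hn⟩ := hb'.exists
  refine hn.trans ?_
  set h : ℝ → ℂ := fun y => (starRingEnd ℂ) (G n y) * ((‖G n y‖ ^ (p - 2) : ℝ) : ℂ) with hh
  have hnorm : ∀ y, ‖h y‖ = ‖G n y‖ ^ (p - 1) := by
    intro y
    rw [hh]
    simp only [norm_mul, RCLike.norm_conj, Complex.norm_real]
    rw [Real.norm_of_nonneg (by positivity)]
    nth_rewrite 1 [← Real.rpow_one ‖G n y‖]
    rw [← Real.rpow_add' (norm_nonneg _) (by linarith)]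
    congr 1
    ring
  have hhm : AEStronglyMeasurable h volume := by
    refine (Complex.continuous_conj.comp_aestronglyMeasurable (hGm n)).mul ?_
    exact Complex.continuous_ofReal.comp_aestronglyMeasurable
      ((hGm n).norm.aemeasurable.pow_const _).aestronglyMeasurable
  have hhmem : ∀ r, MemLp h r volume := fun r =>
    memLp_of_bounded_of_compactSupport hhm (M := M ^ (p - 1)) (R := n)
      (fun y => by
        rw [hnorm]
        exact Real.rpow_le_rpow (norm_nonneg _) (hGM n y) (by linarith))
      (fun y hy => by simp [hh, hGsupp n y hy]) r
  have hmul : ∀ y, h y * g y = ((‖G n y‖ ^ p : ℝ) : ℂ) := by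
    intro y
    have h1 : h y * g y = h y * G n y := by
      by_cases hy : y ∈ Icc (-n : ℝ) n
      · rw [hG]; simp only; rw [indicator_of_mem hy]
      · have : G n y = 0 := indicator_of_notMem hy _
        simp [hh, this]
    rw [h1, hh]
    simp only
    rw [mul_right_comm, mul_comm ((starRingEnd ℂ) _), Complex.mul_conj, Complex.normSq_eq_norm_sq,
      ← Complex.ofReal_mul]
    congr 1
    rw [← Real.rpow_two, ← Real.rpow_add' (norm_nonneg _) (by linarith)]
    congr 1
    ring
  have hGmem : MemLp (G n) (ENNReal.ofReal p) volume :=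
    memLp_of_bounded_of_compactSupport (hGm n) (hGM n) (hGsupp n) _
  set J := eLpNorm (G n) (ENNReal.ofReal p) volume with hJ
  have hhJ : eLpNorm h (ENNReal.ofReal q) volume ≤ J ^ (p / q) := by
    refine eLpNorm_le_of_lintegral_rpow_le hq1 (le_of_eq ?_)
    rw [← ENNReal.rpow_mul, div_mul_cancel₀ _ hq0.ne', hJ, ← lintegral_rpow_eq_eLpNorm_rpow _ hp]
    refine lintegral_congr fun y => ?_
    rw [← ofReal_norm, hnorm, ← ofReal_norm,
      ENNReal.ofReal_rpow_of_nonneg (by positivity) hq0.le,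
      ENNReal.ofReal_rpow_of_nonneg (by positivity) hp0.le, ← Real.rpow_mul (norm_nonneg _), hmulq]
  have hdual : ‖∫ x, h x * g x‖ₑ = J ^ p := by
    simp only [hmul]
    rw [integral_complex_ofReal, enorm_ofReal_complex, Real.enorm_of_nonneg
      (integral_nonneg fun y => Real.rpow_nonneg (norm_nonneg _) _),
      ofReal_integral_eq_lintegral_ofReal, hJ, ← lintegral_rpow_eq_eLpNorm_rpow _ hp]
    · refine lintegral_congr fun y => ?_
      rw [← ofReal_norm, ENNReal.ofReal_rpow_of_nonneg (by positivity) hp0.le]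
    · have := hGmem.integrable_norm_rpow (by simp; linarith) (by simp)
      rwa [ENNReal.toReal_ofReal hp0.le] at this
    · exact ae_of_all _ fun y => Real.rpow_nonneg (norm_nonneg _) _
  -- Skewness moves Q_ε onto the test function, where the bound for exponent q applies. Since p = 1
  -- + p/q, cancelling J^(p/q) leaves the claim.
  have hkey : J ^ p ≤ A * eLpNorm f (ENNReal.ofReal p) volume * J ^ (p / q) := by
    rw [← hdual, integral_mul_kconv_conjPoisson hε hp hf (memLp_one_iff_integrable.1 (hhmem 1)),
      enorm_neg]
    refine (enorm_integral_mul_le hp hf.1 (hb.aestronglyMeasurable_kconv hhm)).trans ?_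
    rw [mul_comm A, mul_assoc]
    gcongr 1
    exact (hAb h (hhmem _) ε hε).trans (by gcongr)
  by_cases hJ0 : J = 0
  · rw [hJ0]; exact zero_le
  have hJtop : J ≠ ∞ := hGmem.2.ne
  have hpq1 : p = 1 + p / q := by
    rw [eq_comm, hq_def, Real.conjExponent]
    field_simp
    ring
  have hJp : J ^ p = J * J ^ (p / q) := by
    conv_lhs => rw [hpq1]
    rw [ENNReal.rpow_add _ _ hJ0 hJtop, ENNReal.rpow_one]
  rw [hJp] at hkey
  exact (ENNReal.mul_le_mul_iff_left (ENNReal.rpow_pos (pos_iff_ne_zero.2 hJ0) hJtop).ne'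
    (ENNReal.rpow_ne_top_of_nonneg (by positivity) hJtop)).1 hkey

theorem conjPoissonBound {p : ℝ} (hp : 1 < p) : ConjPoissonBound p := by
  rcases le_or_gt p 2 with h | h
  · exact conjPoissonBound_of_le_two hp h
  · exact conjPoissonBound_of_two_lt h

/-! ### Pointwise limits at Lebesgue points -/

theorem lintegral_Ioc_rpow_neg_half {b : ℝ} (hb : 0 < b) :
    ∫⁻ t in Ioc 0 b, ENNReal.ofReal (t ^ (-(1 / 2) : ℝ)) = ENNReal.ofReal (2 * b ^ (1 / 2 : ℝ)) := by
  have hi : IntervalIntegrable (fun t : ℝ => t ^ (-(1 / 2) : ℝ)) volume 0 b :=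
    intervalIntegral.intervalIntegrable_rpow' (by norm_num)
  rw [intervalIntegrable_iff_integrableOn_Ioc_of_le hb.le] at hi
  rw [← ofReal_integral_eq_lintegral_ofReal hi, ← intervalIntegral.integral_of_le hb.le,
    integral_rpow (Or.inl (by norm_num))]
  · congr 1
    rw [Real.zero_rpow (by norm_num)]
    norm_num
    ring
  · filter_upwards [ae_restrict_mem measurableSet_Ioc] with t ht
    exact Real.rpow_nonneg ht.1.le _

/-- A measure that grows at most linearly around `x` has bounded Poisson averages at `x`. -/
theorem lintegral_poissonKer_mul_le {ε : ℝ} (hε : 0 < ε) {g : ℝ → ℝ≥0∞}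
    (hg : AEMeasurable g volume) (x : ℝ) (c : ℝ≥0∞)
    (h : ∀ r, 0 < r → ∫⁻ y in Metric.closedBall x r, g y ≤ c * ENNReal.ofReal r) :
    ∫⁻ y, ENNReal.ofReal (poissonKer ε (x - y)) * g y ≤ c := by
  have hπ := Real.pi_pos
  have hm : Measurable fun y => poissonKer ε (x - y) :=
    (measurable_poissonKer ε).comp (by fun_prop)
  set μ := volume.withDensity g with hμ
  have e1 : ∫⁻ y, ENNReal.ofReal (poissonKer ε (x - y)) * g y =
      ∫⁻ y, ENNReal.ofReal (poissonKer ε (x - y)) ∂μ := by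
    rw [hμ, lintegral_withDensity_eq_lintegral_mul₀ hg hm.ennreal_ofReal.aemeasurable]
    exact lintegral_congr fun y => mul_comm _ _
  rw [e1, lintegral_eq_lintegral_meas_le μ (ae_of_all _ fun y => poissonKer_nonneg hε _)
    hm.aemeasurable]
  -- The maximum of the Poisson kernel: in the layer-cake integral, levels t > b contribute nothing.
  set b := (Real.pi * ε)⁻¹ with hb
  have hb0 : 0 < b := by positivity
  have h1 : ∀ t ∈ Ioi (0 : ℝ), μ {y | t ≤ poissonKer ε (x - y)} ≤ (Ioc 0 b).indicator (fun t =>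
      c * ENNReal.ofReal ((ε / Real.pi) ^ (1 / 2 : ℝ)) * ENNReal.ofReal (t ^ (-(1 / 2) : ℝ))) t := by
    intro t ht
    have ht : 0 < t := ht
    by_cases htb : t ≤ b
    · rw [indicator_of_mem (show t ∈ Ioc 0 b from ⟨ht, htb⟩)]
      -- The superlevel set at t lies in the ball with r² = ε/(πt), so its measure is at most c·r.
      -- This is integrable in t near 0, and the total is c·2/π ≤ c.
      set r := (ε / Real.pi) ^ (1 / 2 : ℝ) * t ^ (-(1 / 2) : ℝ) with hr
      have hr0 : 0 < r := by positivity
      have hr2 : r ^ 2 = ε / (Real.pi * t) := by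
        rw [hr, mul_pow, ← Real.rpow_natCast, ← Real.rpow_natCast, ← Real.rpow_mul (by positivity),
          ← Real.rpow_mul ht.le]
        norm_num
        rw [Real.rpow_neg_one]
        field_simp
      have hsub : {y | t ≤ poissonKer ε (x - y)} ⊆ Metric.closedBall x r := by
        intro y hy
        have hy : t ≤ ε / (Real.pi * ((x - y) ^ 2 + ε ^ 2)) := hy
        rw [Metric.mem_closedBall, dist_comm, Real.dist_eq]
        refine abs_le_of_sq_le_sq ?_ hr0.le
        rw [hr2, le_div_iff₀ (by positivity)]
        rw [le_div_iff₀ (by positivity)] at hy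
        nlinarith [mul_pos (mul_pos ht hπ) (sq_pos_of_pos hε)]
      calc μ {y | t ≤ poissonKer ε (x - y)} ≤ μ (Metric.closedBall x r) := measure_mono hsub
        _ = ∫⁻ y in Metric.closedBall x r, g y := withDensity_apply _ Metric.isClosed_closedBall.measurableSet
        _ ≤ c * ENNReal.ofReal r := h r hr0
        _ = _ := by rw [hr, ENNReal.ofReal_mul (by positivity), mul_assoc]
    · have : {y | t ≤ poissonKer ε (x - y)} = ∅ := by
        ext y
        simp only [mem_empty_iff_false, iff_false]
        intro hy
        have hy : t ≤ ε / (Real.pi * ((x - y) ^ 2 + ε ^ 2)) := hy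
        refine htb (hy.trans ?_)
        rw [hb, inv_eq_one_div, div_le_div_iff₀ (by positivity) (by positivity)]
        nlinarith [mul_nonneg hπ.le (sq_nonneg (x - y))]
      rw [this, measure_empty]
      exact zero_le
  calc ∫⁻ t in Ioi (0 : ℝ), μ {y | t ≤ poissonKer ε (x - y)}
      ≤ ∫⁻ t in Ioi (0 : ℝ), (Ioc 0 b).indicator (fun t =>
          c * ENNReal.ofReal ((ε / Real.pi) ^ (1 / 2 : ℝ)) * ENNReal.ofReal (t ^ (-(1 / 2) : ℝ))) t :=
        setLIntegral_mono' measurableSet_Ioi h1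
    _ ≤ ∫⁻ t in Ioc 0 b,
          c * ENNReal.ofReal ((ε / Real.pi) ^ (1 / 2 : ℝ)) * ENNReal.ofReal (t ^ (-(1 / 2) : ℝ)) := by
        rw [← lintegral_indicator measurableSet_Ioc]
        exact setLIntegral_le_lintegral _ _
    _ = c * ENNReal.ofReal ((ε / Real.pi) ^ (1 / 2 : ℝ) * (2 * b ^ (1 / 2 : ℝ))) := by
        rw [lintegral_const_mul _ (by fun_prop), lintegral_Ioc_rpow_neg_half hb0,
          mul_assoc, ← ENNReal.ofReal_mul (by positivity)]
    _ ≤ c * 1 := by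
        gcongr
        rw [ENNReal.ofReal_le_one, mul_left_comm, ← Real.mul_rpow (by positivity) (by positivity)]
        have : ε / Real.pi * b = (Real.pi ^ 2)⁻¹ := by rw [hb]; field_simp
        rw [this, Real.inv_rpow (by positivity), ← Real.rpow_natCast, ← Real.rpow_mul hπ.le]
        norm_num
        rw [← div_eq_mul_inv, div_le_one hπ]
        exact Real.two_le_pi
    _ = c := mul_one c

theorem lintegral_poissonKer_shift {ε : ℝ} (hε : 0 < ε) (x : ℝ) :
    ∫⁻ y, ENNReal.ofReal (poissonKer ε (x - y)) = 1 := by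
  rw [lintegral_sub_left_eq_self (fun y => ENNReal.ofReal (poissonKer ε y)) x,
    lintegral_poissonKer hε]

/-- At almost every point `x` (namely, at Lebesgue points), the Poisson averages of
`|f - f x|` around `x` tend to zero. -/
theorem ae_tendsto_lintegral_poissonKer {p : ℝ} (hp : 1 < p) {f : ℝ → ℂ}
    (hf : MemLp f (ENNReal.ofReal p) volume) :
    ∀ᵐ x, Tendsto (fun ε => ∫⁻ y, ENNReal.ofReal (poissonKer ε (x - y)) * ‖f y - f x‖ₑ)
      (𝓝[>] 0) (𝓝 0) := by
  have hloc : LocallyIntegrable f volume := hf.locallyIntegrable (by simpa using hp.le)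
  filter_upwards [IsUnifLocDoublingMeasure.ae_tendsto_average_norm_sub volume hloc 1] with x hx
  have hx' := hx (fun _ : ℝ => x) id tendsto_id (by
    filter_upwards [self_mem_nhdsWithin] with r hr
    have hr : 0 < r := hr
    simp [hr.le])
  have hgm : AEMeasurable (fun y => ‖f y - f x‖ₑ) volume :=
    (hf.1.sub aestronglyMeasurable_const).enorm
  set D := ∫⁻ y, ENNReal.ofReal (poissonKer 1 (x - y)) * ‖f y - f x‖ₑ with hD
  have hDfin : D < ∞ := by
    have hk : Measurable fun y => ENNReal.ofReal (poissonKer 1 (x - y)) :=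
      ((measurable_poissonKer 1).comp (by fun_prop : Measurable fun y => x - y)).ennreal_ofReal
    have h1 : D ≤ ∫⁻ y, (ENNReal.ofReal (poissonKer 1 (x - y)) * ‖f y‖ₑ +
        ENNReal.ofReal (poissonKer 1 (x - y)) * ‖f x‖ₑ) := by
      refine lintegral_mono fun y => ?_
      rw [← mul_add]
      gcongr
      exact enorm_sub_le
    refine h1.trans_lt ?_
    rw [lintegral_add_right _ (hk.mul_const _), lintegral_mul_const _ hk,
      lintegral_poissonKer_shift one_pos, one_mul]
    refine ENNReal.add_lt_top.2 ⟨?_, by simp⟩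
    have := ((kernelBound_poissonKer one_pos).integrable_mul hp hf x).2
    refine lt_of_eq_of_lt (lintegral_congr fun y => ?_) this
    rw [enorm_mul, enorm_ofReal_complex, Real.enorm_of_nonneg (poissonKer_nonneg one_pos _)]
  rw [ENNReal.tendsto_nhds_zero]
  intro e he
  obtain ⟨η, hη0, hηe⟩ : ∃ η : ℝ, 0 < η ∧ ENNReal.ofReal (2 * η) + ENNReal.ofReal η ≤ e := by
    by_cases het : e = ∞
    · exact ⟨1, one_pos, by simp [het]⟩
    · have : 0 < e.toReal := ENNReal.toReal_pos he.ne' het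
      refine ⟨e.toReal / 3, by positivity, ?_⟩
      rw [← ENNReal.ofReal_add (by positivity) (by positivity)]
      refine ENNReal.ofReal_le_of_le_toReal (by linarith)
  obtain ⟨δ, hδ0, hδ⟩ : ∃ δ > 0, ∀ r, 0 < r → r ≤ δ →
      ∫⁻ y in Metric.closedBall x r, ‖f y - f x‖ₑ ≤ ENNReal.ofReal (2 * η) * ENNReal.ofReal r := by
    have h1 := hx'.eventually (gt_mem_nhds hη0)
    obtain ⟨δ, hδ0, hδ⟩ := mem_nhdsGT_iff_exists_Ioc_subset.1 h1
    refine ⟨δ, hδ0, fun r hr hrδ => ?_⟩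
    have h2 : ⨍ y in Metric.closedBall x r, ‖f y - f x‖ < η := hδ ⟨hr, hrδ⟩
    have hi : IntegrableOn (fun y => f y - f x) (Metric.closedBall x r) volume :=
      (hloc.integrableOn_isCompact (isCompact_closedBall x r)).sub
        (integrableOn_const measure_closedBall_lt_top.ne)
    rw [setAverage_eq, smul_eq_mul, Measure.real, Real.volume_closedBall,
      ENNReal.toReal_ofReal (by linarith), inv_mul_lt_iff₀ (by linarith)] at h2
    rw [← ENNReal.ofReal_mul (by positivity), ← ofReal_integral_norm_eq_lintegral_enorm hi]
    refine ENNReal.ofReal_le_ofReal (h2.le.trans (le_of_eq (by ring)))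
  -- Outside the ball of radius δ, the kernel at ε is at most ε(1 + 1/δ²) times the kernel at 1, so
  -- the far part is controlled by the finite quantity D.
  have hfar : Tendsto (fun ε : ℝ => ENNReal.ofReal (ε * (1 + 1 / δ ^ 2)) * D) (𝓝[>] 0) (𝓝 0) := by
    have h1 : Tendsto (fun ε : ℝ => ENNReal.ofReal (ε * (1 + 1 / δ ^ 2))) (𝓝[>] 0) (𝓝 0) := by
      have : Tendsto (fun ε : ℝ => ENNReal.ofReal (ε * (1 + 1 / δ ^ 2))) (𝓝 0)
          (𝓝 (ENNReal.ofReal (0 * (1 + 1 / δ ^ 2)))) :=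
        (ENNReal.continuous_ofReal.comp (by fun_prop)).tendsto 0
      rw [zero_mul, ENNReal.ofReal_zero] at this
      exact this.mono_left nhdsWithin_le_nhds
    simpa using ENNReal.Tendsto.mul_const (b := D) h1 (Or.inr hDfin.ne)
  filter_upwards [self_mem_nhdsWithin,
    hfar.eventually (ge_mem_nhds (ENNReal.ofReal_pos.2 hη0))] with ε hε hεfar
  have hε : 0 < ε := hε
  refine le_trans ?_ hηe
  rw [← lintegral_add_compl _ (Metric.isClosed_closedBall (x := x) (ε := δ)).measurableSet]
  refine add_le_add ?_ (le_trans ?_ hεfar)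
  · rw [← lintegral_indicator Metric.isClosed_closedBall.measurableSet]
    refine le_trans (le_of_eq (lintegral_congr fun y => ?_)) (lintegral_poissonKer_mul_le hε
      (g := (Metric.closedBall x δ).indicator fun y => ‖f y - f x‖ₑ)
      (hgm.indicator Metric.isClosed_closedBall.measurableSet) x (ENNReal.ofReal (2 * η)) ?_)
    · by_cases hy : y ∈ Metric.closedBall x δ
      · simp only [indicator_of_mem hy]
      · simp only [indicator_of_notMem hy, mul_zero]
    · intro r hr
      rw [setLIntegral_indicator Metric.isClosed_closedBall.measurableSet]
      rcases le_total r δ with hrδ | hrδ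
      · exact (lintegral_mono_set inter_subset_right).trans (hδ r hr hrδ)
      · refine (lintegral_mono_set inter_subset_left).trans ((hδ δ hδ0 le_rfl).trans ?_)
        gcongr
  · rw [hD, ← lintegral_const_mul' _ _ (by simp)]
    refine le_trans (setLIntegral_mono' Metric.isClosed_closedBall.measurableSet.compl
      fun y hy => ?_) (setLIntegral_le_lintegral _ _)
    rw [← mul_assoc, ← ENNReal.ofReal_mul (by positivity)]
    gcongr
    have hy : δ < |x - y| := by
      rwa [mem_compl_iff, Metric.mem_closedBall, dist_comm, Real.dist_eq, not_le] at hy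
    rw [poissonKer, poissonKer, mul_div_assoc', mul_one, div_le_div_iff₀ (by positivity)
      (by positivity)]
    have h3 : δ ^ 2 ≤ (x - y) ^ 2 := by
      rw [← sq_abs (x - y)]
      gcongr
    have h4 : (x - y) ^ 2 + 1 ^ 2 ≤ (1 + 1 / δ ^ 2) * ((x - y) ^ 2 + ε ^ 2) := by
      have h5 : 1 ≤ 1 / δ ^ 2 * (x - y) ^ 2 := by
        rw [div_mul_eq_mul_div, le_div_iff₀ (by positivity)]
        linarith
      have h6 : 0 ≤ (1 + 1 / δ ^ 2) * ε ^ 2 := by positivity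
      linarith
    calc ε * (Real.pi * ((x - y) ^ 2 + 1 ^ 2)) = ε * Real.pi * ((x - y) ^ 2 + 1 ^ 2) := by ring
      _ ≤ ε * Real.pi * ((1 + 1 / δ ^ 2) * ((x - y) ^ 2 + ε ^ 2)) := by gcongr
      _ = _ := by ring

/-- An `L^p`-bounded kernel that is dominated by the Poisson kernel evaluates differences
`f y - f x` to something small. -/
theorem enorm_integral_kernel_sub_le {K : ℝ → ℝ} {ε : ℝ}
    (hK : ∀ y, |K y| ≤ poissonKer ε y) (f : ℝ → ℂ) (x : ℝ) :
    ‖∫ y, (K (x - y) : ℂ) * (f y - f x)‖ₑ ≤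
      ∫⁻ y, ENNReal.ofReal (poissonKer ε (x - y)) * ‖f y - f x‖ₑ := by
  refine (enorm_integral_le_lintegral_enorm _).trans (lintegral_mono fun y => ?_)
  rw [enorm_mul, enorm_ofReal_complex, Real.enorm_eq_ofReal_abs]
  gcongr
  exact hK _

theorem kconv_sub_eq {K : ℝ → ℝ} (hK : KernelBound K) (hKi : Integrable K volume) {p : ℝ}
    (hp : 1 < p) {f : ℝ → ℂ} (hf : MemLp f (ENNReal.ofReal p) volume) (x : ℝ) :
    ∫ y, (K (x - y) : ℂ) * (f y - f x) = kconv K f x - ((∫ y, K y : ℝ) : ℂ) * f x := by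
  simp only [mul_sub]
  have hi : Integrable (fun y => (K (x - y) : ℂ) * f x) volume :=
    (hKi.comp_sub_left x).ofReal.mul_const _
  rw [integral_sub (hK.integrable_mul hp hf x) hi,
    integral_mul_const, integral_complex_ofReal, integral_sub_left_eq_self K, kconv]

theorem ae_tendsto_poisson {p : ℝ} (hp : 1 < p) {f : ℝ → ℂ}
    (hf : MemLp f (ENNReal.ofReal p) volume) :
    ∀ᵐ x, Tendsto (fun ε => kconv (poissonKer ε) f x) (𝓝[>] 0) (𝓝 (f x)) := by
  filter_upwards [ae_tendsto_lintegral_poissonKer hp hf] with x hx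
  rw [tendsto_iff_edist_tendsto_0]
  refine tendsto_of_tendsto_of_tendsto_of_le_of_le' tendsto_const_nhds hx
    (Eventually.of_forall fun _ => zero_le) ?_
  filter_upwards [self_mem_nhdsWithin] with ε hε
  have hε : 0 < ε := hε
  have h1 := kconv_sub_eq (kernelBound_poissonKer hε) (integral_poissonKer hε).1 hp hf x
  rw [(integral_poissonKer hε).2, Complex.ofReal_one, one_mul] at h1
  rw [edist_eq_enorm_sub, ← h1]
  exact enorm_integral_kernel_sub_le (fun y => (abs_of_nonneg (poissonKer_nonneg hε y)).le) f x

/-- The difference kernel is odd, hence has integral 0, so f y may be replaced by f y - f x; being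
dominated by the Poisson kernel, it is then handled by `ae_tendsto_lintegral_poissonKer`. -/
theorem ae_tendsto_truncHilbert_sub {p : ℝ} (hp : 1 < p) {f : ℝ → ℂ}
    (hf : MemLp f (ENNReal.ofReal p) volume) :
    ∀ᵐ x, Tendsto (fun ε => truncHilbert f x ε - kconv (conjPoissonKer ε) f x)
      (𝓝[>] 0) (𝓝 0) := by
  filter_upwards [ae_tendsto_lintegral_poissonKer hp hf] with x hx
  rw [tendsto_iff_edist_tendsto_0]
  refine tendsto_of_tendsto_of_tendsto_of_le_of_le' tendsto_const_nhds hx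
    (Eventually.of_forall fun _ => zero_le) ?_
  filter_upwards [self_mem_nhdsWithin] with ε hε
  have hε : 0 < ε := hε
  have hb := (kernelBound_truncKer hε).sub (kernelBound_conjPoissonKer hε)
  have hi : Integrable (fun y => truncKer ε y - conjPoissonKer ε y) volume :=
    (integral_poissonKer hε).1.mono' hb.measurable.aestronglyMeasurable
      (ae_of_all _ (abs_truncKer_sub_conjPoissonKer_le hε))
  have hodd : ∫ y, (truncKer ε y - conjPoissonKer ε y) = 0 := by
    have h1 := integral_neg_eq_self (fun y => truncKer ε y - conjPoissonKer ε y) volume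
    have h2 : ∀ y, truncKer ε (-y) - conjPoissonKer ε (-y) =
        -(truncKer ε y - conjPoissonKer ε y) := by
      intro y
      rw [conjPoissonKer_neg, truncKer, truncKer, abs_neg]
      split_ifs
      · rw [mul_neg, div_neg]; ring
      · ring
    simp only [h2] at h1
    rw [integral_neg] at h1
    linarith
  have h1 := kconv_sub_eq hb hi hp hf x
  rw [hodd, Complex.ofReal_zero, zero_mul, sub_zero] at h1
  have h2 : truncHilbert f x ε - kconv (conjPoissonKer ε) f x =
      kconv (fun y => truncKer ε y - conjPoissonKer ε y) f x := by
    rw [truncHilbert_eq_kconv, kconv, kconv, kconv, ← integral_sub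
      ((kernelBound_truncKer hε).integrable_mul hp hf x)
      ((kernelBound_conjPoissonKer hε).integrable_mul hp hf x)]
    congr 1
    ext y
    push_cast
    ring
  rw [edist_zero_right, h2, ← h1]
  exact enorm_integral_kernel_sub_le (abs_truncKer_sub_conjPoissonKer_le hε) f x

/-! ### Existence of the Hilbert transform as an L^p boundary function -/

/-- A sequence that converges almost everywhere and whose norms do not exceed the norm of the
limit converges in `L^p`. -/
theorem tendsto_eLpNorm_sub_of_ae_tendsto {p : ℝ} (hp : 1 < p) {f : ℕ → ℝ → ℂ} {g : ℝ → ℂ}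
    (hf : ∀ n, AEStronglyMeasurable (f n) volume) (hg : MemLp g (ENNReal.ofReal p) volume)
    (hle : ∀ n, eLpNorm (f n) (ENNReal.ofReal p) volume ≤ eLpNorm g (ENNReal.ofReal p) volume)
    (hlim : ∀ᵐ x, Tendsto (fun n => f n x) atTop (𝓝 (g x))) :
    Tendsto (fun n => eLpNorm (f n - g) (ENNReal.ofReal p) volume) atTop (𝓝 0) := by
  have hp0 : 0 < p := by linarith
  set c : ℝ≥0∞ := 2 ^ (p - 1) with hc
  have hctop : c ≠ ∞ := ENNReal.rpow_ne_top_of_nonneg (by linarith) (by simp)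
  set N := ∫⁻ x, ‖g x‖ₑ ^ p with hN
  have hNtop : N ≠ ∞ := by
    rw [hN, lintegral_rpow_eq_eLpNorm_rpow g hp]
    exact ENNReal.rpow_ne_top_of_nonneg hp0.le hg.2.ne
  -- Convexity (`hpt`) makes this a true subtraction. Fatou applied to φ n, whose limit is 2c|g|^p,
  -- bounds the lower limit of ∫ φ n below by c(N + N), while `hsum` bounds ∫ φ n + ∫ |f n - g|^p
  -- above by the same value.
  set φ : ℕ → ℝ → ℝ≥0∞ := fun n x => c * (‖f n x‖ₑ ^ p + ‖g x‖ₑ ^ p) - ‖f n x - g x‖ₑ ^ p with hφ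
  have hpt : ∀ n x, ‖f n x - g x‖ₑ ^ p ≤ c * (‖f n x‖ₑ ^ p + ‖g x‖ₑ ^ p) := fun n x =>
    (ENNReal.rpow_le_rpow enorm_sub_le hp0.le).trans
      (ENNReal.rpow_add_le_mul_rpow_add_rpow _ _ hp.le)
  have hdm : ∀ n, AEMeasurable (fun x => ‖f n x - g x‖ₑ ^ p) volume := fun n =>
    ((hf n).sub hg.1).enorm.pow_const p
  have hφm : ∀ n, AEMeasurable (φ n) volume := fun n =>
    ((((hf n).enorm.pow_const p).add (hg.1.enorm.pow_const p)).const_mul c).sub (hdm n)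
  have hsum : ∀ n, (∫⁻ x, φ n x) + ∫⁻ x, ‖f n x - g x‖ₑ ^ p ≤ c * (N + N) := by
    intro n
    rw [← lintegral_add_right' _ (hdm n)]
    calc ∫⁻ x, (φ n x + ‖f n x - g x‖ₑ ^ p) = ∫⁻ x, c * (‖f n x‖ₑ ^ p + ‖g x‖ₑ ^ p) :=
          lintegral_congr fun x => tsub_add_cancel_of_le (hpt n x)
      _ = c * ((∫⁻ x, ‖f n x‖ₑ ^ p) + N) := by
          rw [lintegral_const_mul' _ _ hctop, lintegral_add_right' _ (hg.1.enorm.pow_const p)]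
      _ ≤ c * (N + N) := by
          gcongr
          rw [hN, lintegral_rpow_eq_eLpNorm_rpow _ hp, lintegral_rpow_eq_eLpNorm_rpow _ hp]
          gcongr
          exact hle n
  have hfatou : c * (N + N) ≤ liminf (fun n => ∫⁻ x, φ n x) atTop := by
    refine le_trans (le_of_eq ?_) (lintegral_liminf_le' hφm)
    have h1 : c * (N + N) = ∫⁻ x, c * (‖g x‖ₑ ^ p + ‖g x‖ₑ ^ p) := by
      rw [lintegral_const_mul' _ _ hctop, lintegral_add_right' _ (hg.1.enorm.pow_const p)]
    rw [h1]
    refine lintegral_congr_ae (hlim.mono fun x hx => ?_)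
    symm
    refine Tendsto.liminf_eq ?_
    have h2 : Tendsto (fun n => ‖f n x‖ₑ ^ p) atTop (𝓝 (‖g x‖ₑ ^ p)) :=
      (ENNReal.continuous_rpow_const.tendsto _).comp ((continuous_enorm.tendsto _).comp hx)
    have h3 : Tendsto (fun n => ‖f n x - g x‖ₑ ^ p) atTop (𝓝 0) := by
      have : Tendsto (fun n => ‖f n x - g x‖ₑ ^ p) atTop (𝓝 (‖g x - g x‖ₑ ^ p)) :=
        (ENNReal.continuous_rpow_const.tendsto _).comp
          ((continuous_enorm.tendsto _).comp (hx.sub_const _))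
      simpa [hp0] using this
    have h4 : Tendsto (fun n => c * (‖f n x‖ₑ ^ p + ‖g x‖ₑ ^ p)) atTop
        (𝓝 (c * (‖g x‖ₑ ^ p + ‖g x‖ₑ ^ p))) :=
      ENNReal.Tendsto.const_mul (h2.add tendsto_const_nhds) (Or.inr hctop)
    simpa using ENNReal.Tendsto.sub h4 h3 (Or.inr (by simp))
  have hatop : c * (N + N) ≠ ∞ := ENNReal.mul_ne_top hctop (by simp [hNtop])
  have hd : Tendsto (fun n => ∫⁻ x, ‖f n x - g x‖ₑ ^ p) atTop (𝓝 0) := by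
    rw [ENNReal.tendsto_nhds_zero]
    intro e he
    rcases eq_or_ne (c * (N + N)) 0 with h0 | h0
    · refine Eventually.of_forall fun n => ?_
      have := le_trans le_add_self (hsum n)
      rw [h0] at this
      exact this.trans zero_le
    · have h1 : c * (N + N) - e < liminf (fun n => ∫⁻ x, φ n x) atTop :=
        (ENNReal.sub_lt_self hatop h0 he.ne').trans_le hfatou
      filter_upwards [eventually_lt_of_lt_liminf h1] with n hn
      have hφtop : ∫⁻ x, φ n x ≠ ∞ :=
        ne_top_of_le_ne_top hatop (le_trans le_self_add (hsum n))
      have h2 : c * (N + N) ≤ (∫⁻ x, φ n x) + e := tsub_le_iff_right.1 hn.le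
      exact (ENNReal.add_le_add_iff_left hφtop).1 ((hsum n).trans h2)
  have h5 : Tendsto (fun n => (∫⁻ x, ‖f n x - g x‖ₑ ^ p) ^ (1 / p)) atTop (𝓝 0) := by
    have := (ENNReal.continuous_rpow_const (y := 1 / p)).tendsto 0 |>.comp hd
    simpa [hp0, Function.comp_def] using this
  refine h5.congr fun n => ?_
  rw [eLpNorm_eq_lintegral_rpow_enorm_toReal (by simp; linarith) (by simp),
    ENNReal.toReal_ofReal hp0.le]
  rfl

theorem tendsto_one_div_nat_add_one_nhdsGT :
    Tendsto (fun n : ℕ => 1 / ((n : ℝ) + 1)) atTop (𝓝[>] 0) :=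
  tendsto_nhdsWithin_iff.2 ⟨tendsto_one_div_add_atTop_nhds_zero_nat,
    Eventually.of_forall fun n => show (0 : ℝ) < 1 / ((n : ℝ) + 1) by positivity⟩

/-- The semigroup identities give Q_ε g = P_ε k for the differences g of Poisson and k of conjugate
Poisson integrals. The uniform bound applies to Q_ε g, and ε → 0 recovers k. Thus L^p convergence of
P_η f makes Q_η f Cauchy. -/
theorem eLpNorm_conjPoisson_sub_le {p : ℝ} (hp : 1 < p) {A : ℝ≥0∞}
    (hA : ∀ f : ℝ → ℂ, MemLp f (ENNReal.ofReal p) volume → ∀ ε, 0 < ε →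
      eLpNorm (kconv (conjPoissonKer ε) f) (ENNReal.ofReal p) volume ≤
        A * eLpNorm f (ENNReal.ofReal p) volume)
    (hA_top : A < ∞) {f : ℝ → ℂ} (hf : MemLp f (ENNReal.ofReal p) volume) {η η' : ℝ} (hη : 0 < η)
    (hη' : 0 < η') :
    eLpNorm (kconv (conjPoissonKer η) f - kconv (conjPoissonKer η') f) (ENNReal.ofReal p) volume ≤
      A * eLpNorm (kconv (poissonKer η) f - kconv (poissonKer η') f) (ENNReal.ofReal p) volume := by
  have hm : ∀ δ, 0 < δ → MemLp (kconv (conjPoissonKer δ) f) (ENNReal.ofReal p) volume :=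
    fun δ hδ => ⟨(kernelBound_conjPoissonKer hδ).aestronglyMeasurable_kconv hf.1,
      (hA f hf δ hδ).trans_lt (ENNReal.mul_lt_top hA_top hf.2)⟩
  set g := kconv (poissonKer η) f - kconv (poissonKer η') f with hg
  set k := kconv (conjPoissonKer η) f - kconv (conjPoissonKer η') f with hk
  have hgm : MemLp g (ENNReal.ofReal p) volume :=
    (memLp_poisson hη hp hf).sub (memLp_poisson hη' hp hf)
  have hkm : MemLp k (ENNReal.ofReal p) volume := (hm η hη).sub (hm η' hη')
  have hpos : ∀ n : ℕ, (0 : ℝ) < 1 / ((n : ℝ) + 1) := fun n => by positivity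
  have heq : ∀ ε, 0 < ε → kconv (conjPoissonKer ε) g = kconv (poissonKer ε) k := by
    intro ε hε
    rw [hg, hk, (kernelBound_conjPoissonKer hε).kconv_sub hp (memLp_poisson hη hp hf)
      (memLp_poisson hη' hp hf), (kernelBound_poissonKer hε).kconv_sub hp (hm η hη) (hm η' hη'),
      conjPoisson_poisson hε hη hp hf, conjPoisson_poisson hε hη' hp hf,
      poisson_conjPoisson hε hη hp hf, poisson_conjPoisson hε hη' hp hf]
  refine Lp.eLpNorm_le_of_ae_tendsto (u := atTop)
    (f := fun n : ℕ => kconv (poissonKer (1 / ((n : ℝ) + 1))) k)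
    (Eventually.of_forall fun n => ?_)
    (fun n => (kernelBound_poissonKer (hpos n)).aestronglyMeasurable_kconv hkm.1)
    ((ae_tendsto_poisson hp hkm).mono fun x hx => hx.comp tendsto_one_div_nat_add_one_nhdsGT)
  rw [← heq _ (hpos n)]
  exact hA g hgm _ (hpos n)

/-- The conjugate Poisson integrals of `f ∈ L^p` are the Poisson integrals of a function
`h ∈ L^p`. -/
theorem exists_conjPoisson_eq_poisson {p : ℝ} (hp : 1 < p) {f : ℝ → ℂ}
    (hf : MemLp f (ENNReal.ofReal p) volume) :
    ∃ h : ℝ → ℂ, MemLp h (ENNReal.ofReal p) volume ∧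
      ∀ ε, 0 < ε → kconv (conjPoissonKer ε) f = kconv (poissonKer ε) h := by
  obtain ⟨A, hA_top, hA⟩ := conjPoissonBound hp
  have : Fact (1 ≤ ENNReal.ofReal p) := ⟨by simpa using hp.le⟩
  set η : ℕ → ℝ := fun n => 1 / ((n : ℝ) + 1) with hη
  have hpos : ∀ n : ℕ, 0 < η n := fun n => by simp only [hη]; positivity
  set P : ℕ → ℝ → ℂ := fun n => kconv (poissonKer (η n)) f with hP
  set Q : ℕ → ℝ → ℂ := fun n => kconv (conjPoissonKer (η n)) f with hQ
  have hPm : ∀ n, MemLp (P n) (ENNReal.ofReal p) volume := fun n => memLp_poisson (hpos n) hp hf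
  have hQm : ∀ n, MemLp (Q n) (ENNReal.ofReal p) volume := fun n =>
    ⟨(kernelBound_conjPoissonKer (hpos n)).aestronglyMeasurable_kconv hf.1,
      (hA f hf _ (hpos n)).trans_lt (ENNReal.mul_lt_top hA_top hf.2)⟩
  have hPf : Tendsto (fun n => eLpNorm (P n - f) (ENNReal.ofReal p) volume) atTop (𝓝 0) :=
    tendsto_eLpNorm_sub_of_ae_tendsto hp (fun n => (hPm n).1) hf
      (fun n => eLpNorm_poisson_le (hpos n) hp hf.1)
      ((ae_tendsto_poisson hp hf).mono fun x hx => hx.comp tendsto_one_div_nat_add_one_nhdsGT)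
  have hPc : CauchySeq fun n => (hPm n).toLp := by
    refine Tendsto.cauchySeq (x := hf.toLp) ?_
    rw [tendsto_iff_edist_tendsto_0]
    simpa only [Lp.edist_toLp_toLp] using hPf
  have hQc : CauchySeq fun n => (hQm n).toLp := by
    rw [EMetric.cauchySeq_iff] at hPc ⊢
    intro e he
    -- Dividing by A + 1 instead of A avoids the case A = 0.
    have hA1 : A + 1 ≠ ∞ := by simp [hA_top.ne]
    obtain ⟨N, hN⟩ := hPc (e / (A + 1)) (ENNReal.div_pos he.ne' hA1)
    refine ⟨N, fun m hm n hn => ?_⟩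
    have h1 := hN m hm n hn
    rw [Lp.edist_toLp_toLp] at h1 ⊢
    rw [ENNReal.lt_div_iff_mul_lt (Or.inl (by simp)) (Or.inl hA1), mul_comm] at h1
    refine lt_of_le_of_lt ((eLpNorm_conjPoisson_sub_le hp hA hA_top hf (hpos m) (hpos n)).trans ?_) h1
    gcongr
    exact le_self_add
  obtain ⟨H, hh⟩ := cauchySeq_tendsto_of_complete hQc
  set h : ℝ → ℂ := ⇑H with hdef
  have hhm : MemLp h (ENNReal.ofReal p) volume := Lp.memLp H
  have hQh : Tendsto (fun n => eLpNorm (Q n - h) (ENNReal.ofReal p) volume) atTop (𝓝 0) := by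
    rw [tendsto_iff_edist_tendsto_0] at hh
    refine hh.congr fun n => ?_
    rw [← Lp.toLp_coeFn H hhm, Lp.edist_toLp_toLp]
  refine ⟨h, hhm, fun ε hε => ?_⟩
  ext x
  have h1 := (kernelBound_poissonKer hε).tendsto_kconv hp hQm hhm hQh x
  have h2 := (kernelBound_conjPoissonKer hε).tendsto_kconv hp hPm hf hPf x
  -- Both sequences agree, since Q_ε P_η f = Q_(ε+η) f = P_ε Q_η f with η = η n; their limits are
  -- Q_ε f and P_ε h.
  refine tendsto_nhds_unique h2 (h1.congr fun n => ?_)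
  rw [hP, hQ]
  simp only
  rw [conjPoisson_poisson hε (hpos n) hp hf, poisson_conjPoisson hε (hpos n) hp hf]

theorem ae_tendsto_truncHilbert {p : ℝ} (hp : 1 < p) {f h : ℝ → ℂ}
    (hf : MemLp f (ENNReal.ofReal p) volume) (hh : MemLp h (ENNReal.ofReal p) volume)
    (heq : ∀ ε, 0 < ε → kconv (conjPoissonKer ε) f = kconv (poissonKer ε) h) :
    ∀ᵐ x, Tendsto (truncHilbert f x) (𝓝[>] 0) (𝓝 (h x)) := by
  filter_upwards [ae_tendsto_truncHilbert_sub hp hf, ae_tendsto_poisson hp hh] with x h1 h2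
  have h3 := h1.add h2
  rw [zero_add] at h3
  refine h3.congr' ?_
  filter_upwards [self_mem_nhdsWithin] with ε hε
  rw [heq ε hε, sub_add_cancel]

theorem hilbertTransform_ae_eq {p : ℝ} (hp : 1 < p) {f h : ℝ → ℂ}
    (hf : MemLp f (ENNReal.ofReal p) volume) (hh : MemLp h (ENNReal.ofReal p) volume)
    (heq : ∀ ε, 0 < ε → kconv (conjPoissonKer ε) f = kconv (poissonKer ε) h) :
    hilbertTransform f =ᵐ[volume] h :=
  (ae_tendsto_truncHilbert hp hf hh heq).mono fun _ hx => hx.limUnder_eq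

/-! ### Boundedness of S_a -/

theorem lintegral_comp_mul_left {t : ℝ} (ht : 0 < t) {F : ℝ → ℝ≥0∞} (hF : Measurable F) :
    ENNReal.ofReal t * ∫⁻ x, F (t * x) = ∫⁻ x, F x := by
  have h := Real.smul_map_volume_mul_left ht.ne'
  conv_rhs => rw [← h]
  rw [lintegral_smul_measure, lintegral_map hF (by fun_prop), abs_of_pos ht, smul_eq_mul]

theorem ae_eq_comp_mul_left {E : Type*} {f g : ℝ → E} (h : f =ᵐ[volume] g) {t : ℝ} (ht : t ≠ 0) :
    (fun x => f (t * x)) =ᵐ[volume] fun x => g (t * x) := by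
  have hq : Measure.QuasiMeasurePreserving (fun x : ℝ => t * x) volume volume := by
    refine ⟨by fun_prop, ?_⟩
    rw [Real.map_volume_mul_left ht]
    exact Measure.smul_absolutelyContinuous
  exact hq.ae_eq_comp h

theorem ae_eq_comp_mul_right {E : Type*} {f g : ℝ → E} (h : f =ᵐ[volume] g) {x : ℝ} (hx : x ≠ 0) :
    (fun t => f (t * x)) =ᵐ[volume] fun t => g (t * x) := by
  simpa only [mul_comm] using ae_eq_comp_mul_left h hx

/-- The point x = 0 is genuinely exceptional: there the integrand sees only the single value f(0),
which a null set can change. -/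
theorem adjHausdorff_congr_of_ne_zero (a : ℝ → ℝ) {f g : ℝ → ℂ} (h : f =ᵐ[volume] g) {x : ℝ}
    (hx : x ≠ 0) : adjHausdorff a f x = adjHausdorff a g x :=
  integral_congr_ae (ae_restrict_of_ae ((ae_eq_comp_mul_right h hx).mono fun t ht => by
    simp only at ht ⊢
    rw [ht]))

theorem ae_ne_zero : ∀ᵐ x : ℝ, x ≠ 0 := by
  simp [ae_iff]

theorem adjHausdorff_congr_ae (a : ℝ → ℝ) {f g : ℝ → ℂ} (h : f =ᵐ[volume] g) :
    adjHausdorff a f =ᵐ[volume] adjHausdorff a g :=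
  ae_ne_zero.mono fun _ hx => adjHausdorff_congr_of_ne_zero a h hx

/-- The weighted integral that equals the norm of `adjHausdorff` on `L^p`. -/
noncomputable def hausdorffWeight (p : ℝ) (a : ℝ → ℝ) : ℝ≥0∞ :=
  ∫⁻ t in Ioi (0 : ℝ), ENNReal.ofReal (t ^ (-(1 / p)) * a t)

/-- Split a(t) as t^(-1/p) a(t) times t^(1/p). The first factor becomes the measure μ, of total mass
M; the second normalises the dilation, so every slice t^(1/p) f(t·) has the norm of f. -/
theorem lintegral_adjHausdorff_rpow_le_of_measurable {p : ℝ} (hp : 1 < p) {a : ℝ → ℝ}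
    (ha : Measurable a) (ha0 : ∀ t, 0 ≤ a t) {f : ℝ → ℂ} (hf : Measurable f) :
    ∫⁻ x, (∫⁻ t in Ioi (0 : ℝ), ‖f (t * x) * (a t : ℂ)‖ₑ) ^ p ≤
      hausdorffWeight p a ^ p * ∫⁻ x, ‖f x‖ₑ ^ p := by
  have hp0 : 0 < p := by linarith
  have hwm : Measurable fun t : ℝ => ENNReal.ofReal (t ^ (-(1 / p)) * a t) := by fun_prop
  set μ : Measure ℝ := (volume.restrict (Ioi 0)).withDensity
    fun t => ENNReal.ofReal (t ^ (-(1 / p)) * a t) with hμ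
  have hμ1 : μ univ = hausdorffWeight p a := by
    rw [hμ, withDensity_apply _ MeasurableSet.univ, Measure.restrict_univ, hausdorffWeight]
  have hpos : ∀ᵐ t ∂μ, 0 < t := by
    rw [hμ]
    exact (withDensity_absolutelyContinuous _ _).ae_le (ae_restrict_mem measurableSet_Ioi)
  have hg : Measurable (Function.uncurry fun t x : ℝ =>
      ENNReal.ofReal (t ^ (1 / p)) * ‖f (t * x)‖ₑ) := by
    unfold Function.uncurry
    fun_prop
  have h := lintegral_rpow_lintegral_le μ volume hp hg (B := ∫⁻ x, ‖f x‖ₑ ^ p) (by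
    filter_upwards [hpos] with t ht
    rw [← lintegral_comp_mul_left ht (F := fun x => ‖f x‖ₑ ^ p) (by fun_prop),
      ← lintegral_const_mul' _ _ (by simp)]
    refine lintegral_mono fun x => le_of_eq ?_
    rw [ENNReal.mul_rpow_of_nonneg _ _ hp0.le, ENNReal.ofReal_rpow_of_nonneg (by positivity) hp0.le,
      ← Real.rpow_mul ht.le, one_div_mul_cancel hp0.ne', Real.rpow_one])
  rw [hμ1] at h
  refine le_trans (le_of_eq (lintegral_congr fun x => ?_)) h
  congr 1
  rw [hμ, lintegral_withDensity_eq_lintegral_mul _ hwm (by fun_prop)]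
  refine setLIntegral_congr_fun measurableSet_Ioi fun t ht => ?_
  have ht : 0 < t := ht
  simp only [Pi.mul_apply]
  rw [← mul_assoc, ← ENNReal.ofReal_mul (mul_nonneg (by positivity) (ha0 t)), mul_right_comm,
    ← Real.rpow_add ht, neg_add_cancel, Real.rpow_zero, one_mul, enorm_mul, enorm_ofReal_complex,
    Real.enorm_of_nonneg (ha0 t), mul_comm]

theorem lintegral_adjHausdorff_rpow_le {p : ℝ} (hp : 1 < p) {a : ℝ → ℝ}
    (ha : Measurable a) (ha0 : ∀ t, 0 ≤ a t) {f : ℝ → ℂ} (hf : AEStronglyMeasurable f volume) :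
    ∫⁻ x, (∫⁻ t in Ioi (0 : ℝ), ‖f (t * x) * (a t : ℂ)‖ₑ) ^ p ≤
      hausdorffWeight p a ^ p * ∫⁻ x, ‖f x‖ₑ ^ p := by
  have hfg := hf.ae_eq_mk
  have h := lintegral_adjHausdorff_rpow_le_of_measurable hp ha ha0
    hf.stronglyMeasurable_mk.measurable
  have e1 : ∫⁻ x, ‖hf.mk f x‖ₑ ^ p = ∫⁻ x, ‖f x‖ₑ ^ p :=
    lintegral_congr_ae (hfg.mono fun x hx => by simp only [hx])
  rw [e1] at h
  refine le_trans (le_of_eq (lintegral_congr_ae (ae_ne_zero.mono fun x hx => ?_))) h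
  simp only
  congr 1
  exact lintegral_congr_ae (ae_restrict_of_ae ((ae_eq_comp_mul_right hfg hx).mono fun t ht => by
    simp only at ht ⊢
    rw [ht]))

section Bounded

variable {p : ℝ} {a : ℝ → ℝ} {f : ℝ → ℂ}

theorem aestronglyMeasurable_comp_mul_mul (ha : Measurable a) (hf : AEStronglyMeasurable f volume)
    {x : ℝ} (hx : x ≠ 0) :
    AEStronglyMeasurable (fun t => f (t * x) * (a t : ℂ)) (volume.restrict (Ioi 0)) := by
  refine AEStronglyMeasurable.restrict ?_
  have h1 : AEStronglyMeasurable (fun t => f (t * x)) volume :=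
    ⟨fun t => hf.mk f (t * x), hf.stronglyMeasurable_mk.comp_measurable (by fun_prop),
      ae_eq_comp_mul_right hf.ae_eq_mk hx⟩
  exact h1.mul (Complex.measurable_ofReal.comp ha).aestronglyMeasurable

theorem measurable_lintegral_comp_mul (ha : Measurable a) (hf : Measurable f) :
    Measurable fun x => ∫⁻ t in Ioi (0 : ℝ), ‖f (t * x) * (a t : ℂ)‖ₑ :=
  Measurable.lintegral_prod_right' (f := fun z : ℝ × ℝ => ‖f (z.2 * z.1) * (a z.2 : ℂ)‖ₑ)
    (by fun_prop)

theorem aemeasurable_lintegral_comp_mul (ha : Measurable a) (hf : AEStronglyMeasurable f volume) :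
    AEMeasurable (fun x => ∫⁻ t in Ioi (0 : ℝ), ‖f (t * x) * (a t : ℂ)‖ₑ) volume := by
  refine ⟨_, measurable_lintegral_comp_mul ha hf.stronglyMeasurable_mk.measurable,
    ae_ne_zero.mono fun x hx => ?_⟩
  exact lintegral_congr_ae (ae_restrict_of_ae ((ae_eq_comp_mul_right hf.ae_eq_mk hx).mono
    fun t ht => by
      simp only at ht ⊢
      rw [ht]))

theorem aestronglyMeasurable_adjHausdorff (ha : Measurable a)
    (hf : AEStronglyMeasurable f volume) : AEStronglyMeasurable (adjHausdorff a f) volume := by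
  have hm := hf.stronglyMeasurable_mk.measurable
  have h1 : StronglyMeasurable (adjHausdorff a (hf.mk f)) :=
    StronglyMeasurable.integral_prod_right' (f := fun z : ℝ × ℝ => hf.mk f (z.2 * z.1) * (a z.2 : ℂ))
      (by fun_prop : Measurable fun z : ℝ × ℝ =>
        hf.mk f (z.2 * z.1) * (a z.2 : ℂ)).stronglyMeasurable
  exact ⟨_, h1, adjHausdorff_congr_ae a hf.ae_eq_mk⟩

theorem ae_integrableOn_adjHausdorff (hp : 1 < p) (ha : Measurable a) (ha0 : ∀ t, 0 ≤ a t)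
    (hM : hausdorffWeight p a < ∞) (hf : MemLp f (ENNReal.ofReal p) volume) :
    ∀ᵐ x : ℝ, IntegrableOn (fun t : ℝ => f (t * x) * (a t : ℂ)) (Ioi 0) volume := by
  have hp0 : 0 < p := by linarith
  have h1 := lintegral_adjHausdorff_rpow_le hp ha ha0 hf.1
  rw [lintegral_rpow_eq_eLpNorm_rpow f hp] at h1
  have h2 : hausdorffWeight p a ^ p * eLpNorm f (ENNReal.ofReal p) volume ^ p ≠ ∞ :=
    ENNReal.mul_ne_top (ENNReal.rpow_ne_top_of_nonneg hp0.le hM.ne)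
      (ENNReal.rpow_ne_top_of_nonneg hp0.le hf.2.ne)
  have h3 := ae_lt_top' ((aemeasurable_lintegral_comp_mul ha hf.1).pow_const p)
    (ne_top_of_le_ne_top h2 h1)
  filter_upwards [h3, ae_ne_zero] with x hx hx0
  exact ⟨aestronglyMeasurable_comp_mul_mul ha hf.1 hx0, (ENNReal.rpow_lt_top_iff_of_pos hp0).1 hx⟩

theorem eLpNorm_adjHausdorff_le (hp : 1 < p) (ha : Measurable a) (ha0 : ∀ t, 0 ≤ a t)
    (hf : AEStronglyMeasurable f volume) :
    eLpNorm (adjHausdorff a f) (ENNReal.ofReal p) volume ≤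
      hausdorffWeight p a * eLpNorm f (ENNReal.ofReal p) volume := by
  have hp0 : 0 < p := by linarith
  refine eLpNorm_le_of_lintegral_rpow_le hp ?_
  rw [ENNReal.mul_rpow_of_nonneg _ _ hp0.le, ← lintegral_rpow_eq_eLpNorm_rpow f hp]
  refine le_trans (lintegral_mono fun x => ?_) (lintegral_adjHausdorff_rpow_le hp ha ha0 hf)
  gcongr
  exact enorm_integral_le_lintegral_enorm _

theorem memLp_adjHausdorff (hp : 1 < p) (ha : Measurable a) (ha0 : ∀ t, 0 ≤ a t)
    (hM : hausdorffWeight p a < ∞) (hf : MemLp f (ENNReal.ofReal p) volume) :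
    MemLp (adjHausdorff a f) (ENNReal.ofReal p) volume :=
  ⟨aestronglyMeasurable_adjHausdorff ha hf.1, (eLpNorm_adjHausdorff_le hp ha ha0 hf.1).trans_lt
    (ENNReal.mul_lt_top hM hf.2)⟩

/-! ### Commutation with the Hilbert transform -/

/-- Fubini; absolute convergence is Hölder between K in L^q and the absolute version of S_a f, which
is in L^p. -/
theorem kconv_adjHausdorff_of_measurable (hp : 1 < p) (ha : Measurable a) (ha0 : ∀ t, 0 ≤ a t)
    (hM : hausdorffWeight p a < ∞) (hfm : Measurable f) (hf : MemLp f (ENNReal.ofReal p) volume)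
    {K : ℝ → ℝ} (hK : KernelBound K) (x : ℝ) :
    kconv K (adjHausdorff a f) x =
      ∫ t in Ioi (0 : ℝ), kconv K (fun y => f (t * y)) x * (a t : ℂ) := by
  have hp0 : 0 < p := by linarith
  have hpq := Real.HolderConjugate.conjExponent hp
  have hKm := hK.measurable
  have hF : Measurable fun z : ℝ × ℝ => (K (x - z.1) : ℂ) * (f (z.2 * z.1) * (a z.2 : ℂ)) := by
    fun_prop
  have hint : Integrable (fun z : ℝ × ℝ => (K (x - z.1) : ℂ) * (f (z.2 * z.1) * (a z.2 : ℂ)))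
      (volume.prod (volume.restrict (Ioi 0))) := by
    refine ⟨hF.aestronglyMeasurable, ?_⟩
    rw [HasFiniteIntegral, lintegral_prod _ hF.enorm.aemeasurable]
    have hmem : MemLp (fun y => K (x - y)) (ENNReal.ofReal p.conjExponent) volume :=
      (hK.memLp hpq.symm.lt).comp_measurePreserving (volume.measurePreserving_sub_left x)
    have hS := lintegral_adjHausdorff_rpow_le hp ha ha0 hf.1
    rw [lintegral_rpow_eq_eLpNorm_rpow f hp] at hS
    calc ∫⁻ y, ∫⁻ t in Ioi 0, ‖(K (x - y) : ℂ) * (f (t * y) * (a t : ℂ))‖ₑ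
        = ∫⁻ y, ‖K (x - y)‖ₑ * ∫⁻ t in Ioi (0 : ℝ), ‖f (t * y) * (a t : ℂ)‖ₑ := by
          refine lintegral_congr fun y => ?_
          rw [← enorm_ofReal_complex, ← lintegral_const_mul' _ _ (by simp)]
          simp only [enorm_mul]
      _ ≤ _ := ENNReal.lintegral_mul_le_Lp_mul_Lq volume hpq.symm
          (f := fun y => ‖K (x - y)‖ₑ) (by fun_prop)
          (measurable_lintegral_comp_mul ha hfm).aemeasurable
      _ < ∞ := by
          refine ENNReal.mul_lt_top ?_ ?_
          · have := hmem.2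
            rw [eLpNorm_eq_lintegral_rpow_enorm_toReal (by simp [hpq.symm.pos]) (by simp),
              ENNReal.toReal_ofReal hpq.symm.nonneg] at this
            exact this
          · refine ENNReal.rpow_lt_top_of_nonneg (by positivity) (ne_top_of_le_ne_top ?_ hS)
            exact ENNReal.mul_ne_top (ENNReal.rpow_ne_top_of_nonneg hp0.le hM.ne)
              (ENNReal.rpow_ne_top_of_nonneg hp0.le hf.2.ne)
  calc kconv K (adjHausdorff a f) x
      = ∫ y, ∫ t in Ioi (0 : ℝ), (K (x - y) : ℂ) * (f (t * y) * (a t : ℂ)) := by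
        simp only [kconv, adjHausdorff, integral_const_mul]
    _ = ∫ t in Ioi (0 : ℝ), ∫ y, (K (x - y) : ℂ) * (f (t * y) * (a t : ℂ)) :=
        integral_integral_swap hint
    _ = _ := by
        simp only [kconv, ← integral_mul_const, mul_assoc]

theorem kconv_adjHausdorff (hp : 1 < p) (ha : Measurable a) (ha0 : ∀ t, 0 ≤ a t)
    (hM : hausdorffWeight p a < ∞) (hf : MemLp f (ENNReal.ofReal p) volume)
    {K : ℝ → ℝ} (hK : KernelBound K) (x : ℝ) :
    kconv K (adjHausdorff a f) x =
      ∫ t in Ioi (0 : ℝ), kconv K (fun y => f (t * y)) x * (a t : ℂ) := by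
  have hfg := hf.1.ae_eq_mk
  rw [kconv_congr_ae K (adjHausdorff_congr_ae a hfg), kconv_adjHausdorff_of_measurable hp ha ha0 hM
    hf.1.stronglyMeasurable_mk.measurable (hf.ae_eq hfg) hK x]
  refine setIntegral_congr_fun measurableSet_Ioi fun t ht => ?_
  have ht : 0 < t := ht
  rw [kconv_congr_ae K (ae_eq_comp_mul_left hfg ht.ne')]

theorem kconv_conjPoisson_comp_mul_left (f : ℝ → ℂ) {t : ℝ} (ht : 0 < t) (ε x : ℝ) :
    kconv (conjPoissonKer ε) (fun y => f (t * y)) x = kconv (conjPoissonKer (t * ε)) f (t * x) := by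
  rw [kconv_comp_mul_left _ f ht]
  congr 1
  ext y
  rw [conjPoissonKer, conjPoissonKer]
  have : (t⁻¹ * y) ^ 2 + ε ^ 2 = (y ^ 2 + (t * ε) ^ 2) / t ^ 2 := by field_simp
  rw [this]
  by_cases h : y ^ 2 + (t * ε) ^ 2 = 0
  · simp [h]
  · field_simp

theorem kconv_poisson_comp_mul_left (f : ℝ → ℂ) {t : ℝ} (ht : 0 < t) (ε x : ℝ) :
    kconv (poissonKer ε) (fun y => f (t * y)) x = kconv (poissonKer (t * ε)) f (t * x) := by
  rw [kconv_comp_mul_left _ f ht]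
  congr 1
  ext y
  rw [poissonKer, poissonKer]
  have : (t⁻¹ * y) ^ 2 + ε ^ 2 = (y ^ 2 + (t * ε) ^ 2) / t ^ 2 := by field_simp
  rw [this]
  by_cases h : y ^ 2 + (t * ε) ^ 2 = 0
  · simp [h]
  · field_simp

/-- Under dilation by t both kernels pass to scale tε evaluated at tx, so the hypothesis at scale tε
identifies the integrands for each t. This is why it is required at every scale. -/
theorem conjPoisson_adjHausdorff (hp : 1 < p) (ha : Measurable a) (ha0 : ∀ t, 0 ≤ a t)
    (hM : hausdorffWeight p a < ∞) {h : ℝ → ℂ} (hf : MemLp f (ENNReal.ofReal p) volume)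
    (hh : MemLp h (ENNReal.ofReal p) volume)
    (heq : ∀ ε, 0 < ε → kconv (conjPoissonKer ε) f = kconv (poissonKer ε) h) {ε : ℝ} (hε : 0 < ε) :
    kconv (conjPoissonKer ε) (adjHausdorff a f) = kconv (poissonKer ε) (adjHausdorff a h) := by
  ext x
  rw [kconv_adjHausdorff hp ha ha0 hM hf (kernelBound_conjPoissonKer hε),
    kconv_adjHausdorff hp ha ha0 hM hh (kernelBound_poissonKer hε)]
  refine setIntegral_congr_fun measurableSet_Ioi fun t ht => ?_
  have ht : 0 < t := ht
  rw [kconv_conjPoisson_comp_mul_left f ht, kconv_poisson_comp_mul_left h ht,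
    heq _ (mul_pos ht hε)]

theorem adjHausdorff_hilbertTransform (hp : 1 < p) (ha : Measurable a) (ha0 : ∀ t, 0 ≤ a t)
    (hM : hausdorffWeight p a < ∞) (hf : MemLp f (ENNReal.ofReal p) volume) :
    (∀ᵐ x : ℝ, HilbertPVExists f x) ∧ MemLp (hilbertTransform f) (ENNReal.ofReal p) volume ∧
      adjHausdorff a (hilbertTransform f) =ᵐ[volume] hilbertTransform (adjHausdorff a f) := by
  obtain ⟨h, hh, heq⟩ := exists_conjPoisson_eq_poisson hp hf
  have hHf := hilbertTransform_ae_eq hp hf hh heq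
  refine ⟨(ae_tendsto_truncHilbert hp hf hh heq).mono fun x hx => ⟨_, hx⟩,
    hh.ae_eq hHf.symm, ?_⟩
  exact (adjHausdorff_congr_ae a hHf).trans (hilbertTransform_ae_eq hp
    (memLp_adjHausdorff hp ha ha0 hM hf) (memLp_adjHausdorff hp ha ha0 hM hh)
    fun ε hε => conjPoisson_adjHausdorff hp ha ha0 hM hf hh heq hε).symm

end Bounded

/-! ### Sharpness of the constant -/

theorem lintegral_Ioi_rpow_neg {s c : ℝ} (hs : 0 < s) (hc : 0 < c) :
    ∫⁻ x in Ioi c, ENNReal.ofReal (x ^ (-1 - s)) = ENNReal.ofReal (c ^ (-s) / s) := by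
  rw [← ofReal_integral_eq_lintegral_ofReal (integrableOn_Ioi_rpow_of_lt (by linarith) hc),
    integral_Ioi_rpow_of_lt (by linarith) hc]
  · congr 1
    rw [show -1 - s + 1 = -s by ring, neg_div_neg_eq]
  · filter_upwards [ae_restrict_mem measurableSet_Ioi] with x hx
    exact Real.rpow_nonneg (hc.trans hx).le _

/-- The functions that show that the bound for `adjHausdorff` is sharp. -/
noncomputable def powerTail (p δ : ℝ) : ℝ → ℝ := (Ioi 1).indicator fun x => x ^ (-(1 / p) - δ)

theorem powerTail_nonneg (p δ x : ℝ) : 0 ≤ powerTail p δ x :=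
  indicator_nonneg (fun _ hx => Real.rpow_nonneg (zero_le_one.trans (le_of_lt hx)) _) x

theorem measurable_powerTail (p δ : ℝ) : Measurable (powerTail p δ) :=
  (by fun_prop : Measurable fun x : ℝ => x ^ (-(1 / p) - δ)).indicator measurableSet_Ioi

theorem ofReal_rpow_neg_sub_rpow {p δ x : ℝ} (hp : 0 < p) (hx : 0 < x) :
    ENNReal.ofReal (x ^ (-(1 / p) - δ)) ^ p = ENNReal.ofReal (x ^ (-1 - δ * p)) := by
  rw [ENNReal.ofReal_rpow_of_nonneg (by positivity) hp.le, ← Real.rpow_mul hx.le]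
  congr 2
  field_simp

theorem lintegral_powerTail_rpow {p δ : ℝ} (hp : 0 < p) (hδ : 0 < δ) :
    ∫⁻ x, ‖(powerTail p δ x : ℂ)‖ₑ ^ p = ENNReal.ofReal (1 / (δ * p)) := by
  have h := lintegral_Ioi_rpow_neg (mul_pos hδ hp) one_pos
  rw [Real.one_rpow] at h
  rw [← h, ← lintegral_indicator measurableSet_Ioi]
  refine lintegral_congr fun x => ?_
  rw [enorm_ofReal_complex, Real.enorm_of_nonneg (powerTail_nonneg p δ x), powerTail]
  by_cases hx : x ∈ Ioi (1 : ℝ)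
  · rw [indicator_of_mem hx, indicator_of_mem hx, ofReal_rpow_neg_sub_rpow hp (one_pos.trans hx)]
  · rw [indicator_of_notMem hx, indicator_of_notMem hx, ENNReal.ofReal_zero,
      ENNReal.zero_rpow_of_pos hp]

theorem memLp_powerTail {p δ : ℝ} (hp : 1 < p) (hδ : 0 < δ) :
    MemLp (fun x => (powerTail p δ x : ℂ)) (ENNReal.ofReal p) volume := by
  have hp0 : 0 < p := by linarith
  refine ⟨(Complex.measurable_ofReal.comp (measurable_powerTail p δ)).aestronglyMeasurable, ?_⟩
  rw [← ENNReal.rpow_lt_top_iff_of_pos hp0, ← lintegral_rpow_eq_eLpNorm_rpow _ hp,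
    lintegral_powerTail_rpow hp0 hδ]
  exact ENNReal.ofReal_lt_top

/-- For x > N and t > 1/N the product tx exceeds 1, so the power factors as x^(-1/p-δ) t^(-1/p-δ);
the remaining t contribute nonnegatively. -/
theorem enorm_adjHausdorff_powerTail_ge {p δ : ℝ} {a : ℝ → ℝ} (ha : Measurable a)
    (ha0 : ∀ t, 0 ≤ a t) {N x : ℝ} (hN : 0 < N) (hx : N < x)
    (hint : IntegrableOn (fun t : ℝ => (powerTail p δ (t * x) : ℂ) * (a t : ℂ)) (Ioi 0) volume) :
    ENNReal.ofReal (x ^ (-(1 / p) - δ)) *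
        ∫⁻ t in Ioi (1 / N), ENNReal.ofReal (t ^ (-(1 / p) - δ) * a t) ≤
      ‖adjHausdorff a (fun y => (powerTail p δ y : ℂ)) x‖ₑ := by
  have hx0 : 0 < x := hN.trans hx
  have hnn : ∀ t, 0 ≤ powerTail p δ (t * x) * a t := fun t =>
    mul_nonneg (powerTail_nonneg _ _ _) (ha0 t)
  have hint' : IntegrableOn (fun t : ℝ => powerTail p δ (t * x) * a t) (Ioi 0) volume := by
    rw [IntegrableOn] at hint ⊢
    simpa using hint.re
  have e : adjHausdorff a (fun y => (powerTail p δ y : ℂ)) x =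
      ((∫ t in Ioi (0 : ℝ), powerTail p δ (t * x) * a t : ℝ) : ℂ) := by
    rw [adjHausdorff, ← integral_complex_ofReal]
    simp
  rw [e, enorm_ofReal_complex, Real.enorm_of_nonneg (integral_nonneg hnn),
    ofReal_integral_eq_lintegral_ofReal hint' (ae_of_all _ hnn), ← lintegral_const_mul _ (by fun_prop)]
  have hsub : Ioi (1 / N) ⊆ Ioi 0 := Ioi_subset_Ioi (by positivity)
  refine le_trans (setLIntegral_mono' measurableSet_Ioi fun t ht => ?_) (lintegral_mono_set hsub)
  have ht' : 1 / N < t := ht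
  have ht0 : 0 < t := hsub ht
  have htx : 1 < t * x := by
    rw [div_lt_iff₀ hN] at ht'
    nlinarith
  rw [powerTail, indicator_of_mem (show t * x ∈ Ioi (1 : ℝ) from htx),
    ← ENNReal.ofReal_mul (by positivity), Real.mul_rpow ht0.le hx0.le]
  exact ENNReal.ofReal_le_ofReal (le_of_eq (by ring))

theorem lintegral_tail_le_of_bound {p : ℝ} (hp : 1 < p) {a : ℝ → ℝ} (ha : Measurable a)
    (ha0 : ∀ t, 0 ≤ a t) {C : ℝ≥0∞} {N δ : ℝ} (hN : 1 ≤ N) (hδ : 0 < δ)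
    (hint : ∀ᵐ x : ℝ, IntegrableOn (fun t : ℝ => (powerTail p δ (t * x) : ℂ) * (a t : ℂ))
      (Ioi 0) volume)
    (hC : eLpNorm (adjHausdorff a fun y => (powerTail p δ y : ℂ)) (ENNReal.ofReal p) volume ≤
      C * eLpNorm (fun y => (powerTail p δ y : ℂ)) (ENNReal.ofReal p) volume) :
    ∫⁻ t in Ioi (1 / N), ENNReal.ofReal (N ^ (-δ) * (t ^ (-(1 / p) - δ) * a t)) ≤ C := by
  have hp0 : 0 < p := by linarith
  have hN0 : 0 < N := by linarith
  set I := ∫⁻ t in Ioi (1 / N), ENNReal.ofReal (t ^ (-(1 / p) - δ) * a t) with hI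
  have e1 : ∫⁻ t in Ioi (1 / N), ENNReal.ofReal (N ^ (-δ) * (t ^ (-(1 / p) - δ) * a t)) =
      ENNReal.ofReal (N ^ (-δ)) * I := by
    rw [hI, ← lintegral_const_mul _ (by fun_prop)]
    refine lintegral_congr fun t => ?_
    rw [ENNReal.ofReal_mul (by positivity)]
  have hC' := ENNReal.rpow_le_rpow hC hp0.le
  rw [ENNReal.mul_rpow_of_nonneg _ _ hp0.le, ← lintegral_rpow_eq_eLpNorm_rpow _ hp,
    ← lintegral_rpow_eq_eLpNorm_rpow _ hp, lintegral_powerTail_rpow hp0 hδ] at hC'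
  have hlow : ENNReal.ofReal (N ^ (-(δ * p)) / (δ * p)) * I ^ p ≤
      ∫⁻ x, ‖adjHausdorff a (fun y => (powerTail p δ y : ℂ)) x‖ₑ ^ p := by
    rw [← lintegral_Ioi_rpow_neg (mul_pos hδ hp0) hN0, ← lintegral_mul_const _ (by fun_prop)]
    refine le_trans (lintegral_mono_ae ?_) (setLIntegral_le_lintegral (Ioi N) _)
    filter_upwards [ae_restrict_of_ae hint, ae_restrict_mem measurableSet_Ioi] with x hx hxN
    have hxN : N < x := hxN
    rw [← ofReal_rpow_neg_sub_rpow hp0 (hN0.trans hxN), ← ENNReal.mul_rpow_of_nonneg _ _ hp0.le]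
    gcongr
    exact enorm_adjHausdorff_powerTail_ge ha ha0 hN0 hxN hx
  have h1 := hlow.trans hC'
  -- The factor 1/(δp) is the p-th power of the norm of the test function. It diverges as δ → 0 but
  -- cancels here, and restricting to x > N costs only N^(-δ).
  have e2 : ENNReal.ofReal (N ^ (-(δ * p)) / (δ * p)) * I ^ p =
      (ENNReal.ofReal (N ^ (-δ)) * I) ^ p * ENNReal.ofReal (1 / (δ * p)) := by
    rw [ENNReal.mul_rpow_of_nonneg _ _ hp0.le, ENNReal.ofReal_rpow_of_nonneg (by positivity) hp0.le,
      ← Real.rpow_mul hN0.le, mul_right_comm, ← ENNReal.ofReal_mul (by positivity), neg_mul,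
      mul_one_div]
  rw [e2, ENNReal.mul_le_mul_iff_left (by simp; positivity) (by simp),
    ENNReal.rpow_le_rpow_iff hp0] at h1
  rwa [e1]

theorem hausdorffWeight_le_of_bound {p : ℝ} (hp : 1 < p) {a : ℝ → ℝ} (ha : Measurable a)
    (ha0 : ∀ t, 0 ≤ a t) {C : ℝ≥0∞}
    (h : ∀ f : ℝ → ℂ, MemLp f (ENNReal.ofReal p) volume →
      (∀ᵐ x : ℝ, IntegrableOn (fun t : ℝ => f (t * x) * (a t : ℂ)) (Ioi 0) volume) ∧
      eLpNorm (adjHausdorff a f) (ENNReal.ofReal p) volume ≤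
        C * eLpNorm f (ENNReal.ofReal p) volume) :
    hausdorffWeight p a ≤ C := by
  set N : ℕ → ℝ := fun n => (n : ℝ) + 1 with hNdef
  have hN1 : ∀ n, 1 ≤ N n := fun n => by simp [hNdef]
  have hN0 : ∀ n, 0 < N n := fun n => by linarith [hN1 n]
  have hNtop : Tendsto N atTop atTop :=
    tendsto_atTop_add_const_right _ 1 tendsto_natCast_atTop_atTop
  have hδ0 : Tendsto (fun n => 1 / N n) atTop (𝓝 0) := tendsto_one_div_add_atTop_nhds_zero_nat
  -- The choice δ = 1/N lets both parameters move together: N^(-1/N) → 1 and the cutoff 1/N → 0, so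
  -- F n tends pointwise on (0, ∞) to the integrand of M.
  set F : ℕ → ℝ → ℝ≥0∞ := fun n => (Ioi (1 / N n)).indicator fun t =>
    ENNReal.ofReal (N n ^ (-(1 / N n)) * (t ^ (-(1 / p) - 1 / N n) * a t)) with hF
  have hFm : ∀ n, Measurable (F n) := fun n =>
    (by fun_prop : Measurable fun t : ℝ =>
      ENNReal.ofReal (N n ^ (-(1 / N n)) * (t ^ (-(1 / p) - 1 / N n) * a t))).indicator
      measurableSet_Ioi
  have hFC : ∀ n, ∫⁻ t in Ioi (0 : ℝ), F n t ≤ C := by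
    intro n
    have hδ : 0 < 1 / N n := one_div_pos.2 (hN0 n)
    obtain ⟨h1, h2⟩ := h _ (memLp_powerTail hp hδ)
    refine le_trans ?_ (lintegral_tail_le_of_bound hp ha ha0 (hN1 n) hδ h1 h2)
    refine (setLIntegral_le_lintegral _ _).trans (le_of_eq ?_)
    exact lintegral_indicator measurableSet_Ioi _
  have hlim : ∀ t ∈ Ioi (0 : ℝ),
      ENNReal.ofReal (t ^ (-(1 / p)) * a t) = liminf (fun n => F n t) atTop := by
    intro t ht
    have ht : 0 < t := ht
    symm
    refine Tendsto.liminf_eq ?_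
    have h1 : Tendsto (fun n => N n ^ (-(1 / N n))) atTop (𝓝 1) := by
      have := (tendsto_rpow_div.comp hNtop).inv₀ one_ne_zero
      rw [inv_one] at this
      exact this.congr fun n => by
        simp only [Function.comp]
        rw [Real.rpow_neg (hN0 n).le]
    have h2 : Tendsto (fun n => t ^ (-(1 / p) - 1 / N n)) atTop (𝓝 (t ^ (-(1 / p)))) := by
      have : Tendsto (fun n => -(1 / p) - 1 / N n) atTop (𝓝 (-(1 / p) - 0)) :=
        tendsto_const_nhds.sub hδ0
      rw [sub_zero] at this
      exact ((Real.continuous_const_rpow ht.ne').tendsto _).comp this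
    have h3 : Tendsto (fun n => ENNReal.ofReal
        (N n ^ (-(1 / N n)) * (t ^ (-(1 / p) - 1 / N n) * a t))) atTop
        (𝓝 (ENNReal.ofReal (1 * (t ^ (-(1 / p)) * a t)))) :=
      (ENNReal.continuous_ofReal.tendsto _).comp (h1.mul (h2.mul_const _))
    rw [one_mul] at h3
    refine h3.congr' ?_
    filter_upwards [hδ0.eventually (gt_mem_nhds ht)] with n hn
    simp only [hF]
    rw [indicator_of_mem (show t ∈ Ioi (1 / N n) from hn)]
  calc hausdorffWeight p a = ∫⁻ t in Ioi (0 : ℝ), liminf (fun n => F n t) atTop :=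
        setLIntegral_congr_fun measurableSet_Ioi hlim
    _ ≤ liminf (fun n => ∫⁻ t in Ioi (0 : ℝ), F n t) atTop := lintegral_liminf_le hFm
    _ ≤ C := by
        refine liminf_le_of_le (by isBoundedDefault) fun b hb => ?_
        obtain ⟨n, hn⟩ := hb.exists
        exact hn.trans (hFC n)

/-! ### The theorem -/

theorem adjHausdorffBounded_iff_of_measurable {p : ℝ} (hp : 1 < p) {a : ℝ → ℝ} (ha : Measurable a)
    (ha0 : ∀ t, 0 ≤ a t) :
    AdjHausdorffBounded (ENNReal.ofReal p) a ↔ hausdorffWeight p a < ∞ := by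
  constructor
  · rintro ⟨C, hC, h⟩
    exact (hausdorffWeight_le_of_bound hp ha ha0 fun f hf => ⟨(h f hf).1, (h f hf).2.2⟩).trans_lt hC
  · intro hM
    exact ⟨_, hM, fun f hf => ⟨ae_integrableOn_adjHausdorff hp ha ha0 hM hf,
      memLp_adjHausdorff hp ha ha0 hM hf, eLpNorm_adjHausdorff_le hp ha ha0 hf.1⟩⟩

theorem adjHausdorffNorm_eq_of_measurable {p : ℝ} (hp : 1 < p) {a : ℝ → ℝ} (ha : Measurable a)
    (ha0 : ∀ t, 0 ≤ a t) (hM : hausdorffWeight p a < ∞) :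
    adjHausdorffNorm (ENNReal.ofReal p) a = hausdorffWeight p a := by
  refine le_antisymm (sInf_le fun f hf => eLpNorm_adjHausdorff_le hp ha ha0 hf.1)
    (le_sInf fun C hC => ?_)
  exact hausdorffWeight_le_of_bound hp ha ha0 fun f hf =>
    ⟨ae_integrableOn_adjHausdorff hp ha ha0 hM hf, hC f hf⟩

theorem theorem3p6 (p : ℝ) (hp : 1 < p) (a : ℝ → ℝ)
    (ha_meas : AEMeasurable a (volume.restrict (Ioi 0)))
    (ha_nonneg : ∀ t : ℝ, 0 < t → 0 ≤ a t) :
    (AdjHausdorffBounded (ENNReal.ofReal p) a ↔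
      ∫⁻ t in Ioi (0 : ℝ), ENNReal.ofReal (t ^ (-(1 / p)) * a t) < ∞) ∧
    (∫⁻ t in Ioi (0 : ℝ), ENNReal.ofReal (t ^ (-(1 / p)) * a t) < ∞ →
      adjHausdorffNorm (ENNReal.ofReal p) a =
        ∫⁻ t in Ioi (0 : ℝ), ENNReal.ofReal (t ^ (-(1 / p)) * a t) ∧
      ∀ f : ℝ → ℂ, MemLp f (ENNReal.ofReal p) volume →
        (∀ᵐ x : ℝ, HilbertPVExists f x) ∧
        MemLp (hilbertTransform f) (ENNReal.ofReal p) volume ∧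
        adjHausdorff a (hilbertTransform f) =ᵐ[volume] hilbertTransform (adjHausdorff a f)) := by
  -- A measurable representative, nonnegative everywhere. It agrees with a almost everywhere on (0,
  -- ∞), and all the quantities involved depend on a only through that class.
  set b : ℝ → ℝ := fun t => max (ha_meas.mk a t) 0 with hb
  have hbm : Measurable b := ha_meas.measurable_mk.max measurable_const
  have hb0 : ∀ t, 0 ≤ b t := fun t => le_max_right _ _
  have hab : a =ᵐ[volume.restrict (Ioi 0)] b := by
    filter_upwards [ha_meas.ae_eq_mk, ae_restrict_mem measurableSet_Ioi] with t ht h0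
    rw [hb]
    simp only
    rw [← ht, max_eq_left (ha_nonneg t h0)]
  have hS : adjHausdorff a = adjHausdorff b := by
    ext f x
    exact integral_congr_ae (hab.mono fun t ht => by simp only [ht])
  have hM : ∫⁻ t in Ioi (0 : ℝ), ENNReal.ofReal (t ^ (-(1 / p)) * a t) = hausdorffWeight p b :=
    lintegral_congr_ae (hab.mono fun t ht => by simp only [ht])
  have hB : AdjHausdorffBounded (ENNReal.ofReal p) a ↔ AdjHausdorffBounded (ENNReal.ofReal p) b := by
    have hi : ∀ (f : ℝ → ℂ) (x : ℝ),
        IntegrableOn (fun t : ℝ => f (t * x) * (a t : ℂ)) (Ioi 0) volume ↔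
        IntegrableOn (fun t : ℝ => f (t * x) * (b t : ℂ)) (Ioi 0) volume := fun f x =>
      integrable_congr (hab.mono fun t ht => by simp only [ht])
    simp only [AdjHausdorffBounded, hS, hi]
  have hN : adjHausdorffNorm (ENNReal.ofReal p) a = adjHausdorffNorm (ENNReal.ofReal p) b := by
    simp only [adjHausdorffNorm, hS]
  rw [hB, hN, hM, hS]
  exact ⟨adjHausdorffBounded_iff_of_measurable hp hbm hb0, fun h =>
    ⟨adjHausdorffNorm_eq_of_measurable hp hbm hb0 h, fun f hf =>
      adjHausdorff_hilbertTransform hp hbm hb0 h hf⟩⟩
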